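/- Let $p\ge 5$ be a prime and let $\mathbb{Z}_{(p)}\subset\mathbb{Q}$ be the ring of $p$-integral rational numbers. For even $k\ge 2$ let $$G_k=-\frac{B_k}{2k}+\sum_{n\ge1}\sigma_{k-1}(n)q^n,\qquad E_k=-\frac{2k}{B_k}\,G_k,$$ where $B_k$ is the $k$-th Bernoulli number and $\sigma_{k-1}(n)=\sum_{d\mid n}d^{k-1}$. Let $M_w$ be the space of modular forms of weight $w$ on $\mathrm{SL}_2(\mathbb{Z})$ whose Fourier coefficients lie in $\mathbb{Z}_{(p)}$, each form being identified with its $q$-expansion; congruences modulo $p^m$ between $q$-expansions are coefficientwise in $\mathbb{Z}_{(p)}$. The factor filtration of $f$ modulo $p^m$ is $$\tilde\omega_{p^m}(f)=\inf\{w:\ f\equiv E_{p-1}^{\,n}\,g \pmod{p^m}\ \text{for some } n\ge0 \text{ and some } g\in M_w\}.$$ Let $k\ge4$ be an even integer written as $k=\alpha(p-1)+k_0$ with $2\le k_0\le p-3$. In each list below the first condition that holds applies. 1. If $k_0\ge 6$, then $$\tilde\omega_{p^4}(G_k)\le\begin{cases}(p-1)+k_0,&\text{if }\alpha\equiv0,1\pmod{p^2};\\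 2(p-1)+k_0,&\text{if }\alpha\equiv0,1,2\pmod p;\\ 3(p-1)+k_0,&\text{otherwise.}\end{cases}$$ 2. If $k_0=4$, then $$\tilde\omega_{p^4}(G_k)\le\begin{cases}(p-1)+4,&\text{if }\alpha\equiv1\pmod{p^2};\\ 2(p-1)+4,&\text{if }\alpha\equiv1,2\pmod p;\\ 3(p-1)+4,&\text{if }\alpha\equiv3\pmod p;\\ 4(p-1)+4,&\text{otherwise.}\end{cases}$$ 3. If $k_0=2$, then $$\tilde\omega_{p^4}(G_k)\le\begin{cases}(p-1)+2,&\text{if }\alpha\equiv1\pmod{p^2};\\ 2(p-1)+2,&\text{if }\alpha\equiv2\pmod{p^2};\\ 3(p-1)+2,&\text{if }\alpha\equiv1,2,3\pmod p;\\ 4(p-1)+2,&\text{otherwise.}\end{cases}$$ -/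

import Mathlib

open scoped MatrixGroups

/-- The Eisenstein series `G_k = -B_k / (2k) + ∑_{n ≥ 1} σ_{k-1}(n) q^n`, as a `q`-series over `ℚ`
(used for even `k ≥ 2`). -/
noncomputable def eisensteinG (k : ℕ) : PowerSeries ℚ :=
  PowerSeries.mk fun n =>
    if n = 0 then -(bernoulli k) / (2 * (k : ℚ)) else (ArithmeticFunction.sigma (k - 1) n : ℚ)

/-- The normalized Eisenstein series `E_k = 1 - (2k / B_k) ∑_{n ≥ 1} σ_{k-1}(n) q^n`, as a
`q`-series over `ℚ` (used for even `k`; here `E_0 = 1`). -/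
noncomputable def eisensteinE (k : ℕ) : PowerSeries ℚ :=
  PowerSeries.mk fun n =>
    if n = 0 then 1
    else -(2 * (k : ℚ) / bernoulli k) * (ArithmeticFunction.sigma (k - 1) n : ℚ)

/-- A rational number is `p`-integral, i.e. lies in `ℤ_(p)`, if `p` does not divide its
denominator in lowest terms. -/
def IsPIntegral (p : ℕ) (x : ℚ) : Prop := ¬ p ∣ x.den

/-- Coefficientwise congruence of `q`-series: every coefficient of `f - g` lies in `p^m ℤ_(p)`. -/
def QCongr (p m : ℕ) (f g : PowerSeries ℚ) : Prop :=
  ∀ n : ℕ, ∃ c : ℚ, IsPIntegral p c ∧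
    PowerSeries.coeff n f - PowerSeries.coeff n g = (p : ℚ) ^ m * c

/-- The space `M_k` of modular forms of weight `k` on `SL₂(ℤ)` with Fourier coefficients in
`ℤ_(p)`, every form being identified with its Fourier expansion. -/
def integralForms (p k : ℕ) : Set (PowerSeries ℚ) :=
  {f | (∀ n : ℕ, IsPIntegral p (PowerSeries.coeff n f)) ∧
    ∃ F : ModularForm 𝒮ℒ (k : ℤ),
      UpperHalfPlane.qExpansion 1 F = PowerSeries.map (algebraMap ℚ ℂ) f}

/-- The factor filtration modulo `p^m`: the infimum of the weights `w` such that
`f ≡ E_{p-1}^n g (mod p^m)` for some `n ≥ 0` and some `g ∈ M_w`. The infimum is taken in `ℕ∞`, so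
it is `⊤` if there is no such weight. Negative weights need not be considered: there `M_w = 0`,
so they could only matter for `f ≡ 0`. -/
noncomputable def factorFiltration (p m : ℕ) (f : PowerSeries ℚ) : ℕ∞ :=
  sInf {w : ℕ∞ | ∃ (k n : ℕ) (g : PowerSeries ℚ), w = (k : ℕ∞) ∧ g ∈ integralForms p k ∧
    QCongr p m f (eisensteinE (p - 1) ^ n * g)}

/-! Let `w_α = α(p-1) + k₀`, let `G*` be the `p`-deprived Eisenstein series of weight `w_α`, and set
`F_α = E_{p-1}^{-α} G*`. The `j`-th finite differences of `F` in `α` are divisible by `p^j` for `j ≤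
4`. For the nonconstant coefficients of `G*` this is Fermat's congruence `d^(p-1) ≡ 1 (mod p)`, for
the constant term it is the Kummer congruences for `B_k/k` (`exists_kummerSeq_bernoulli`), and
dividing by `E_{p-1}^α` is harmless because `E_{p-1} ≡ 1 (mod p)`.

Newton interpolation then expresses `F_α` modulo `p^4` as an integral combination `∑ c_i F_i` with
`i ≤ 3`. The quadratic or cubic term drops out when `p` divides the binomial coefficients of `α`
sufficiently often. Multiplying by `E_{p-1}^α` gives `G_k ≡ E_{p-1}^{α-s} ∑ c_i E_{p-1}^{s-i}
G_{w_i}`, a form of weight `w_s` times a power of `E_{p-1}` (`factorFiltration_le_of_combination`).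

Passing between `G*` and `G` in weight `w` costs an error `p^(w-1)`, so only `i = 0` is delicate.
For `k₀ ≥ 6` nothing is lost. For `k₀ = 4` the error is `p^3`, so `c_0` must be divisible by `p`.
For `k₀ = 2` the series `G_2` is not modular, so `c_0` must vanish. When `c_0` is not good enough,
interpolation starts at `α = 1` instead of `0`, which costs one more multiple of `p - 1`.

The exception is `k₀ = 2`, `α ≡ 1 (mod p²)`. There `p² ∣ c_0`, and modulo `p²` the series `E_{p-1}
G_2*` is a form of weight `p + 1`, built from the Serre derivative of `E_{p-1}`
(`exists_weight_two_congr`). -/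

/-- A sequence satisfies Kummer congruences of order `r` with respect to `ϖ` if its `j`-th
differences are divisible by `ϖ ^ j` for `j ≤ r`, recursively. -/
def KummerSeq {R : Type*} [CommRing R] (ϖ : R) : ℕ → (ℕ → R) → Prop
  | 0, _ => True
  | r + 1, a => ∃ b : ℕ → R, KummerSeq ϖ r b ∧ ∀ n, a (n + 1) - a n = ϖ * b n

/-! ### Algebra of Kummer congruences -/

namespace KummerSeq

variable {R : Type*} [CommRing R] {ϖ : R}

theorem of_succ {r : ℕ} {a : ℕ → R} (h : KummerSeq ϖ (r + 1) a) : KummerSeq ϖ r a := by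
  induction r generalizing a with
  | zero => trivial
  | succ r ih =>
    obtain ⟨b, hb, hab⟩ := h
    exact ⟨b, ih hb, hab⟩

theorem shift {r : ℕ} {a : ℕ → R} (h : KummerSeq ϖ r a) : KummerSeq ϖ r fun n => a (n + 1) := by
  induction r generalizing a with
  | zero => trivial
  | succ r ih =>
    obtain ⟨b, hb, hab⟩ := h
    exact ⟨_, ih hb, fun n => hab (n + 1)⟩

theorem const (r : ℕ) (x : R) : KummerSeq ϖ r fun _ => x := by
  induction r generalizing x with
  | zero => trivial
  | succ r ih => exact ⟨_, ih 0, fun n => by simp⟩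

theorem add {r : ℕ} {a b : ℕ → R} (ha : KummerSeq ϖ r a) (hb : KummerSeq ϖ r b) :
    KummerSeq ϖ r fun n => a n + b n := by
  induction r generalizing a b with
  | zero => trivial
  | succ r ih =>
    obtain ⟨a', ha', haa⟩ := ha
    obtain ⟨b', hb', hbb⟩ := hb
    exact ⟨_, ih ha' hb', fun n => by linear_combination haa n + hbb n⟩

/-- Discrete Leibniz rule: the difference of `a b` is `b n` times the difference of `a` plus `a (n +
1)` times that of `b`. -/
theorem mul {r : ℕ} {a b : ℕ → R} (ha : KummerSeq ϖ r a) (hb : KummerSeq ϖ r b) :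
    KummerSeq ϖ r fun n => a n * b n := by
  induction r generalizing a b with
  | zero => trivial
  | succ r ih =>
    have ha₁ := ha.of_succ.shift
    have hb₁ := hb.of_succ
    obtain ⟨a', ha', haa⟩ := ha
    obtain ⟨b', hb', hbb⟩ := hb
    exact ⟨_, (ih ha₁ hb').add (ih ha' hb₁), fun n => by
      linear_combination b n * haa n + a (n + 1) * hbb n⟩

theorem sum {ι : Type*} (s : Finset ι) {r : ℕ} {a : ι → ℕ → R}
    (h : ∀ i ∈ s, KummerSeq ϖ r (a i)) : KummerSeq ϖ r fun n => ∑ i ∈ s, a i n := by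
  classical
  induction s using Finset.induction_on with
  | empty => simpa using const r 0
  | insert i s hi ih =>
    simp only [Finset.sum_insert hi]
    exact (h i (by simp)).add (ih fun j hj => h j (by simp [hj]))

theorem pow (r : ℕ) {u : R} (hu : ϖ ∣ u - 1) : KummerSeq ϖ r fun n => u ^ n := by
  obtain ⟨v, hv⟩ := hu
  induction r with
  | zero => trivial
  | succ r ih =>
    exact ⟨_, (const r v).mul ih, fun n => by
      linear_combination u ^ n * hv⟩

theorem inverse {r : ℕ} {a b : ℕ → R} (ha : KummerSeq ϖ r a) (hab : ∀ n, a n * b n = 1) :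
    KummerSeq ϖ r b := by
  induction r with
  | zero => trivial
  | succ r ih =>
    have hb := ih ha.of_succ
    obtain ⟨a', ha', haa⟩ := ha
    exact ⟨_, (const r (-1)).mul (ha'.mul (hb.mul hb.shift)), fun n => by
      linear_combination (-(b n * b (n + 1))) * haa n - b (n + 1) * hab n + b n * hab (n + 1)⟩

/-- Each iterated difference involves finitely many terms, and quotients by `ϖ` are unique in a
domain, so the witnesses for different `N` agree. This is needed because the moment representation
of Bernoulli numbers only covers a bounded range of weights at a time. -/
theorem of_local [IsDomain R] (hϖ : ϖ ≠ 0) {r : ℕ} {a : ℕ → R}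
    (h : ∀ N, ∃ a', KummerSeq ϖ r a' ∧ ∀ n ≤ N, a' n = a n) : KummerSeq ϖ r a := by
  induction r generalizing a with
  | zero => trivial
  | succ r ih =>
    have h' : ∀ n, ∃ b, a (n + 1) - a n = ϖ * b := fun n => by
      obtain ⟨a', ⟨b, -, hb⟩, haa⟩ := h (n + 1)
      exact ⟨b n, by rw [← haa (n + 1) le_rfl, ← haa n (by omega), hb]⟩
    choose b hb using h'
    refine ⟨b, ih fun N => ?_, hb⟩
    obtain ⟨a', ⟨b', hb', hab'⟩, haa⟩ := h (N + 1)
    refine ⟨b', hb', fun n hn => mul_left_cancel₀ hϖ ?_⟩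
    rw [← hab', ← hb, haa (n + 1) (by omega), haa n (by omega)]

theorem newton {r : ℕ} {a : ℕ → R} (h : KummerSeq ϖ r a) :
    ∃ d : ℕ → R, ∀ n, ϖ ^ r ∣ a n - ∑ j ∈ Finset.range r, (n.choose j : R) * ϖ ^ j * d j := by
  induction r generalizing a with
  | zero => exact ⟨0, fun n => by simp⟩
  | succ r ih =>
    obtain ⟨b, hb, hab⟩ := h
    obtain ⟨d, hd⟩ := ih hb
    -- The leading Newton coefficient is `a 0`; the others are those of the divided difference `b`,
    -- moved up one place.
    refine ⟨fun j => Nat.casesOn j (a 0) d, fun n => ?_⟩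
    rw [Finset.sum_range_succ']
    simp only [Nat.choose_zero_right, Nat.cast_one, one_mul, pow_zero]
    change ϖ ^ (r + 1) ∣
      a n - (∑ j ∈ Finset.range r, (n.choose (j + 1) : R) * ϖ ^ (j + 1) * d j + a 0)
    induction n with
    | zero => simp
    | succ n ihn =>
      have : a (n + 1) - (∑ j ∈ Finset.range r,
            ((n + 1).choose (j + 1) : R) * ϖ ^ (j + 1) * d j + a 0) =
          (a n - (∑ j ∈ Finset.range r, (n.choose (j + 1) : R) * ϖ ^ (j + 1) * d j + a 0)) +
          ϖ * (b n - ∑ j ∈ Finset.range r, (n.choose j : R) * ϖ ^ j * d j) := by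
        simp only [Nat.choose_succ_succ, Nat.cast_add, add_mul, Finset.sum_add_distrib, mul_sub,
          Finset.mul_sum]
        have : ∀ j, ϖ * ((n.choose j : R) * ϖ ^ j * d j) = (n.choose j : R) * ϖ ^ (j + 1) * d j :=
          fun j => by ring
        simp only [this]
        linear_combination hab n
      rw [this]
      refine dvd_add ihn ?_
      rw [pow_succ']
      exact mul_dvd_mul_left _ (hd n)

theorem powerSeries {r : ℕ} {a : ℕ → PowerSeries R}
    (h : ∀ m, KummerSeq ϖ r fun n => PowerSeries.coeff m (a n)) :
    KummerSeq (PowerSeries.C ϖ) r a := by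
  induction r generalizing a with
  | zero => trivial
  | succ r ih =>
    choose b hb hab using h
    refine ⟨fun n => PowerSeries.mk fun m => b m n, ih fun m => by simpa using hb m, fun n => ?_⟩
    ext m
    simpa using hab m n

end KummerSeq

/-! ### Coefficientwise divisibility and the local ring `ℤ_(p)` -/

theorem natCast_pow_dvd_powerSeries_iff {p : ℕ} {R : Type*} [CommRing R] {n : ℕ} {f : PowerSeries R} :
    (p : PowerSeries R) ^ n ∣ f ↔ ∀ m, (p : R) ^ n ∣ PowerSeries.coeff m f := by
  have hC : (p : PowerSeries R) ^ n = PowerSeries.C ((p : R) ^ n) := by simp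
  constructor
  · rintro ⟨g, rfl⟩ m
    rw [hC, PowerSeries.coeff_C_mul]
    exact dvd_mul_right _ _
  · intro h
    choose g hg using h
    refine ⟨PowerSeries.mk g, PowerSeries.ext fun m => ?_⟩
    rw [hC, PowerSeries.coeff_C_mul, hg, PowerSeries.coeff_mk]

/-- The ring `ℤ_(p)` of `p`-integral rational numbers. -/
def pIntegers (p : ℕ) [hp : Fact p.Prime] : Subring ℚ where
  carrier := {x | IsPIntegral p x}
  mul_mem' {x y} hx hy h := (hp.out.dvd_mul.mp (h.trans (Rat.mul_den_dvd x y))).elim hx hy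
  one_mem' h := hp.out.one_lt.ne' (Nat.dvd_one.mp h)
  add_mem' {x y} hx hy h := (hp.out.dvd_mul.mp (h.trans (Rat.add_den_dvd x y))).elim hx hy
  zero_mem' h := hp.out.one_lt.ne' (Nat.dvd_one.mp h)
  neg_mem' {x} hx h := hx (by simpa using h)

section

variable {p : ℕ} [hp : Fact p.Prime]

theorem inv_intCast_mem_pIntegers {m : ℤ} (hm : ¬ (p : ℤ) ∣ m) : (m : ℚ)⁻¹ ∈ pIntegers p := by
  intro h
  rw [Rat.inv_intCast_den] at h
  split_ifs at h with h0
  · simp [h0] at hm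
  · exact hm (Int.natCast_dvd.mpr h)

theorem pIntegers_isUnit_intCast {m : ℤ} (hm : ¬ (p : ℤ) ∣ m) : IsUnit (m : pIntegers p) := by
  have h0 : (m : ℚ) ≠ 0 := by rintro h; simp [Int.cast_eq_zero.mp h] at hm
  exact IsUnit.of_mul_eq_one ⟨_, inv_intCast_mem_pIntegers hm⟩ (Subtype.ext (by simp [h0]))

theorem pIntegers_isUnit_natCast {m : ℕ} (hm : ¬ p ∣ m) : IsUnit (m : pIntegers p) := by
  simpa using pIntegers_isUnit_intCast (p := p) (m := m) (by exact_mod_cast hm)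

theorem pIntegers_isUnit_of_not_dvd {x : pIntegers p} (hx : ¬ (p : pIntegers p) ∣ x) :
    IsUnit x := by
  have hden : IsUnit ((x : ℚ).den : pIntegers p) := pIntegers_isUnit_natCast x.2
  have hxe : x * ((x : ℚ).den : pIntegers p) = ((x : ℚ).num : pIntegers p) :=
    Subtype.ext (by simp)
  refine isUnit_of_mul_isUnit_left (y := ((x : ℚ).den : pIntegers p)) ?_
  rw [hxe]
  refine pIntegers_isUnit_intCast fun ⟨m, hm⟩ => hx ?_
  rw [← hden.dvd_mul_right, hxe, hm]
  exact ⟨m, by push_cast; rfl⟩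

theorem pIntegers_p_ne_zero : (p : pIntegers p) ≠ 0 := by
  intro h
  have := congrArg Subtype.val h
  simp [hp.out.ne_zero] at this

theorem p_dvd_pow_sub_one {d : ℕ} (hd : ¬ p ∣ d) {R : Type*} [CommRing R] :
    (p : R) ∣ (d : R) ^ (p - 1) - 1 := by
  have h : (p : ℤ) ∣ (d : ℤ) ^ (p - 1) - 1 := by
    rw [← ZMod.intCast_zmod_eq_zero_iff_dvd]
    push_cast
    rw [ZMod.pow_card_sub_one_eq_one, sub_self]
    rwa [Ne, ZMod.natCast_eq_zero_iff]
  simpa using map_dvd (Int.castRingHom R) h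

end

/-! ### Polynomials supported on exponents prime to `p` -/

open Polynomial in
/-- Polynomials all of whose exponents are prime to `p` (i.e. not multiples of `p`). -/
def PrimeToSupport (p : ℕ) : Submodule ℤ ℤ[X] where
  carrier := {Q | ∀ n, Q.coeff (p * n) = 0}
  add_mem' {a b} ha hb n := by simp [ha n, hb n]
  zero_mem' n := by simp
  smul_mem' c a ha n := by simp [ha n]

namespace PrimeToSupport
open Polynomial

variable {p : ℕ}

theorem X_pow_mem {n : ℕ} (hn : ¬ p ∣ n) : (X ^ n : ℤ[X]) ∈ PrimeToSupport p := fun m => by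
  rw [coeff_X_pow, if_neg]
  rintro rfl
  exact hn (dvd_mul_right _ _)

theorem mul_expand {Q : ℤ[X]} (hQ : Q ∈ PrimeToSupport p) (hp : 0 < p) (A : ℤ[X]) :
    Q * expand ℤ p A ∈ PrimeToSupport p := fun n => by
  rw [coeff_mul]
  refine Finset.sum_eq_zero fun x hx => ?_
  rw [Finset.HasAntidiagonal.mem_antidiagonal] at hx
  rw [coeff_expand hp]
  split_ifs with h
  · obtain ⟨j, hj⟩ := (Nat.dvd_add_iff_left h).mpr (hx ▸ dvd_mul_right p n)
    rw [hj, hQ j, zero_mul]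
  · rw [mul_zero]

/-- The image of `PrimeToSupport p` under multiplication by `X ^ p - 1`. -/
noncomputable def multiples (p : ℕ) : Submodule ℤ ℤ[X] :=
  (PrimeToSupport p).map (LinearMap.mulLeft ℤ (X ^ p - 1 : ℤ[X]))

theorem mem_multiples {N : ℤ[X]} :
    N ∈ multiples p ↔ ∃ Q ∈ PrimeToSupport p, (X ^ p - 1) * Q = N := by
  simp [multiples]

theorem X_pow_add_sub_mem (hp : 0 < p) {n : ℕ} (hn : ¬ p ∣ n) (m : ℕ) :
    (X ^ (n + p * m) - X ^ n : ℤ[X]) ∈ multiples p := by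
  refine mem_multiples.mpr
    ⟨X ^ n * expand ℤ p (∑ i ∈ Finset.range m, X ^ i), mul_expand (X_pow_mem hn) hp _, ?_⟩
  have h := mul_geom_sum (X ^ p : ℤ[X]) m
  simp only [map_sum, map_pow, expand_X]
  rw [mul_left_comm, h, pow_add, pow_mul]
  ring

theorem X_pow_sub_mod_mem (hp : 0 < p) {n : ℕ} (hn : ¬ p ∣ n) :
    (X ^ n - X ^ (n % p) : ℤ[X]) ∈ multiples p := by
  have h := X_pow_add_sub_mem hp (n := n % p) (by rwa [Nat.dvd_mod_iff dvd_rfl]) (n / p)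
  rwa [Nat.mod_add_div] at h

/-- Modulo `multiples p`, exponents prime to `p` may be reduced mod `p`. Multiplication by `c`
permutes the nonzero residues, so both sums reduce to `c ∑ X^i`. -/
theorem sum_mem_multiples [hp : Fact p.Prime] {c : ℕ} (hc : ¬ p ∣ c) :
    (∑ i ∈ Finset.Ico 1 p, ((c : ℤ[X]) * X ^ (c * i) - ∑ m ∈ Finset.range c, X ^ (i + p * m))) ∈
      multiples p := by
  have hp0 := hp.out.pos
  have hnd : ∀ i ∈ Finset.Ico 1 p, ¬ p ∣ i := fun i hi h => by
    rw [Finset.mem_Ico] at hi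
    exact absurd (Nat.le_of_dvd hi.1 h) (by omega)
  have hnd' : ∀ i ∈ Finset.Ico 1 p, ¬ p ∣ c * i := fun i hi h =>
    (hp.out.dvd_mul.mp h).elim hc (hnd i hi)
  have hperm : ∑ i ∈ Finset.Ico 1 p, (X : ℤ[X]) ^ (c * i % p) = ∑ i ∈ Finset.Ico 1 p, X ^ i := by
    have hmaps : ∀ i ∈ Finset.Ico 1 p, c * i % p ∈ Finset.Ico 1 p := fun i hi =>
      Finset.mem_Ico.mpr ⟨Nat.pos_of_ne_zero fun h => hnd' i hi (Nat.dvd_of_mod_eq_zero h),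
        Nat.mod_lt _ hp0⟩
    have hinj : Set.InjOn (fun i => c * i % p) (Finset.Ico 1 p : Finset ℕ) := by
      intro i hi j hj hij
      have hcop : Nat.gcd p c = 1 := (Nat.Prime.coprime_iff_not_dvd hp.out).mpr hc
      have := Nat.ModEq.cancel_left_of_coprime hcop (show c * i ≡ c * j [MOD p] from hij)
      simp only [Finset.coe_Ico, Set.mem_Ico] at hi hj
      exact Nat.ModEq.eq_of_lt_of_lt this hi.2 hj.2
    refine Finset.sum_nbij (fun i => c * i % p) hmaps hinj ?_ fun _ _ => rfl
    exact (Finset.surjOn_of_injOn_of_card_le _ hmaps hinj le_rfl)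
  have key : (∑ i ∈ Finset.Ico 1 p,
      ((c : ℤ[X]) * X ^ (c * i) - ∑ m ∈ Finset.range c, X ^ (i + p * m))) =
      ∑ i ∈ Finset.Ico 1 p, ((c : ℤ) • (X ^ (c * i) - X ^ (c * i % p) : ℤ[X]) -
        ∑ m ∈ Finset.range c, (X ^ (i + p * m) - X ^ i)) := by
    simp only [Finset.sum_sub_distrib, smul_sub, Finset.sum_const, Finset.card_range, ← Finset.smul_sum,
      hperm]
    simp only [zsmul_eq_mul, nsmul_eq_mul, ← Finset.mul_sum]
    push_cast
    ring
  rw [key]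
  refine Submodule.sum_mem _ fun i hi => Submodule.sub_mem _ (Submodule.smul_mem _ _ ?_)
    (Submodule.sum_mem _ fun m _ => ?_)
  · exact X_pow_sub_mod_mem hp0 (hnd' i hi)
  · exact X_pow_add_sub_mem hp0 (hnd i hi) m

end PrimeToSupport

/-! ### Regularized Bernoulli numbers as moments of integer polynomials -/

section

open Polynomial

/-- The evaluation of integer polynomials at the power series `exp`. -/
noncomputable def evalExp : ℤ[X] →+* PowerSeries ℚ :=
  (aeval (PowerSeries.exp ℚ)).toRingHom

theorem evalExp_X_pow (n : ℕ) :
    evalExp (X ^ n) = PowerSeries.rescale (n : ℚ) (PowerSeries.exp ℚ) := by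
  simp [evalExp, PowerSeries.exp_pow_eq_rescale_exp]

theorem coeff_evalExp (W : ℤ[X]) (m : ℕ) :
    PowerSeries.coeff m (evalExp W) * m.factorial = W.sum fun j w => (w : ℚ) * (j : ℚ) ^ m := by
  have : evalExp W = W.sum fun j w => (w : PowerSeries ℚ) * evalExp (X ^ j) := by
    conv_lhs => rw [← W.sum_C_mul_X_pow_eq]
    simp [Polynomial.sum, evalExp, map_sum]
  rw [this, Polynomial.sum, Polynomial.sum, map_sum, Finset.sum_mul]
  refine Finset.sum_congr rfl fun j _ => ?_
  have h0 : (m.factorial : ℚ) ≠ 0 := by exact_mod_cast m.factorial_ne_zero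
  rw [evalExp_X_pow, ← map_intCast (PowerSeries.C (R := ℚ)), PowerSeries.coeff_C_mul,
    PowerSeries.coeff_rescale, PowerSeries.coeff_exp]
  simp
  field_simp

theorem evalExp_X_pow_sub_one_mul (n : ℕ) :
    evalExp (X ^ n - 1) * PowerSeries.rescale (n : ℚ) (bernoulliPowerSeries ℚ) =
      (n : PowerSeries ℚ) * PowerSeries.X := by
  have h := congrArg (PowerSeries.rescale (n : ℚ)) (bernoulliPowerSeries_mul_exp_sub_one ℚ)
  rw [map_mul, map_sub, map_one, PowerSeries.rescale_X] at h
  rw [map_sub, map_one, evalExp_X_pow, mul_comm, h]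
  simp

theorem evalExp_X_pow_sub_one_ne_zero {n : ℕ} (hn : n ≠ 0) : evalExp (X ^ n - 1) ≠ 0 := by
  intro h
  have h1 := evalExp_X_pow_sub_one_mul n
  rw [h, zero_mul] at h1
  have := congrArg (PowerSeries.coeff 1) h1
  rw [← map_natCast (PowerSeries.C (R := ℚ)), PowerSeries.coeff_C_mul] at this
  simp at this
  exact hn (by exact_mod_cast this.symm)

/-- The exponential generating series of `(c ^ k - 1) * (1 - p ^ (k - 1)) * B_k / k`. -/
noncomputable def regularizedBernoulliSeries (p c : ℕ) : PowerSeries ℚ :=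
  PowerSeries.mk fun m =>
    ((c : ℚ) ^ (m + 1) - 1) * (1 - (p : ℚ) ^ m) * _root_.bernoulli (m + 1) / (m + 1).factorial

theorem X_mul_regularizedBernoulliSeries {p : ℕ} (hp : p ≠ 0) (c : ℕ) :
    PowerSeries.X * ((p : PowerSeries ℚ) * regularizedBernoulliSeries p c) =
      (p : PowerSeries ℚ) * (PowerSeries.rescale (c : ℚ) (bernoulliPowerSeries ℚ) -
        PowerSeries.rescale ((1 : ℕ) : ℚ) (bernoulliPowerSeries ℚ)) -
      (PowerSeries.rescale ((p * c : ℕ) : ℚ) (bernoulliPowerSeries ℚ) -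
        PowerSeries.rescale (p : ℚ) (bernoulliPowerSeries ℚ)) := by
  have hp' : (p : ℚ) ≠ 0 := by exact_mod_cast hp
  ext m
  rw [← map_natCast (PowerSeries.C (R := ℚ))]
  cases m with
  | zero =>
    simp only [map_sub, PowerSeries.coeff_C_mul, PowerSeries.coeff_rescale,
      PowerSeries.coeff_zero_X_mul]
    simp
  | succ m =>
    rw [PowerSeries.coeff_succ_X_mul]
    simp only [map_sub, PowerSeries.coeff_C_mul, PowerSeries.coeff_rescale, bernoulliPowerSeries,
      regularizedBernoulliSeries, PowerSeries.coeff_mk, Algebra.algebraMap_self, RingHom.id_apply]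
    push_cast
    ring

/-- The series is `c/(e^{ct}-1) - 1/(e^t-1) - c/(e^{pct}-1) + 1/(e^{pt}-1)`. Multiplying by
`e^{pct}-1` gives the numerator `c K - P D - c + D`, which `sum_mem_multiples` shows to be `X^p - 1`
times a polynomial with exponents prime to `p`. -/
theorem exists_regularizedBernoulliSeries_mul {p : ℕ} [hp : Fact p.Prime] {c : ℕ} (hc : ¬ p ∣ c) :
    ∃ Q ∈ PrimeToSupport p, regularizedBernoulliSeries p c *
      evalExp (expand ℤ p (∑ i ∈ Finset.range c, X ^ i)) = evalExp Q := by
  obtain ⟨Q, hQ, hQN⟩ := PrimeToSupport.mem_multiples.mp (PrimeToSupport.sum_mem_multiples hc)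
  refine ⟨Q, hQ, ?_⟩
  have hp0 := hp.out.ne_zero
  have hc0 : c ≠ 0 := by rintro rfl; simp at hc
  set D : ℤ[X] := expand ℤ p (∑ i ∈ Finset.range c, X ^ i) with hD
  have hD' : D = ∑ i ∈ Finset.range c, X ^ (p * i) := by
    simp [hD, map_sum, pow_mul]
  have hDp : (X ^ p - 1) * D = X ^ (p * c) - 1 := by
    simp only [hD', pow_mul]
    exact mul_geom_sum _ _
  set P : ℤ[X] := ∑ i ∈ Finset.range p, X ^ i with hP
  have hPp : (X ^ 1 - 1) * (P * D) = X ^ (p * c) - 1 := by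
    rw [← mul_assoc, pow_one, mul_geom_sum, hDp]
  set K : ℤ[X] := ∑ i ∈ Finset.range p, X ^ (c * i) with hK
  have hKp : (X ^ c - 1) * K = X ^ (p * c) - 1 := by
    simp only [hK, pow_mul, mul_comm p]
    exact mul_geom_sum _ _
  have hN : (X ^ p - 1) * Q = (c : ℤ[X]) * K - P * D - (c : ℤ[X]) + D := by
    rw [hQN, Finset.sum_sub_distrib, ← Finset.mul_sum]
    have h1 : K = ∑ i ∈ Finset.Ico 1 p, X ^ (c * i) + 1 := by
      rw [hK, Finset.range_eq_Ico, Finset.sum_eq_sum_Ico_succ_bot hp.out.pos]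
      simp [add_comm]
    have h2 : P * D = ∑ i ∈ Finset.Ico 1 p, ∑ m ∈ Finset.range c, X ^ (i + p * m) + D := by
      rw [hP, Finset.range_eq_Ico, Finset.sum_eq_sum_Ico_succ_bot hp.out.pos, add_mul, hD',
        Finset.sum_mul_sum]
      simp [add_comm, pow_add]
    rw [h1, h2]
    ring
  have hX : (PowerSeries.X : PowerSeries ℚ) * (p : PowerSeries ℚ) ≠ 0 := by
    refine mul_ne_zero PowerSeries.X_ne_zero ?_
    rw [← map_natCast (PowerSeries.C (R := ℚ)), Ne, map_eq_zero_iff _ PowerSeries.C_injective]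
    exact Nat.cast_ne_zero.mpr hp0
  refine mul_left_cancel₀ hX (mul_left_cancel₀ (evalExp_X_pow_sub_one_ne_zero hp0) ?_)
  have e1 := evalExp_X_pow_sub_one_mul 1
  have e2 := evalExp_X_pow_sub_one_mul c
  have e3 := evalExp_X_pow_sub_one_mul p
  have e4 := evalExp_X_pow_sub_one_mul (p * c)
  have m1 := congrArg evalExp hDp
  have m2 := congrArg evalExp hPp
  have m3 := congrArg evalExp hKp
  have m4 : evalExp (X ^ p - 1) * evalExp Q = (c : PowerSeries ℚ) * evalExp K -
      evalExp P * evalExp D - (c : PowerSeries ℚ) + evalExp D := by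
    rw [← map_mul, hN]
    simp
  have hL := X_mul_regularizedBernoulliSeries hp0 c
  rw [map_mul] at m1 m2 m3
  rw [map_mul] at m2
  rw [Nat.cast_one (R := PowerSeries ℚ)] at e1
  rw [Nat.cast_mul (α := PowerSeries ℚ)] at e4
  linear_combination evalExp (X ^ p - 1) * evalExp D * hL +
    (p : PowerSeries ℚ) * PowerSeries.rescale (c : ℚ) (bernoulliPowerSeries ℚ) * (m1 - m3) +
    (p : PowerSeries ℚ) * evalExp K * e2 -
    (p : PowerSeries ℚ) * PowerSeries.rescale ((1 : ℕ) : ℚ) (bernoulliPowerSeries ℚ) * (m1 - m2) -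
    (p : PowerSeries ℚ) * evalExp P * evalExp D * e1 -
    PowerSeries.rescale ((p * c : ℕ) : ℚ) (bernoulliPowerSeries ℚ) * m1 - e4 + evalExp D * e3 -
    (p : PowerSeries ℚ) * PowerSeries.X * m4

/-- The denominator `∑_{i<c} X^{pi}` equals `c - x(X^p)` with `x` divisible by `X - 1`. A truncated
geometric series inverts it up to the factor `c^(M+1)` and an error `x^(M+1)`, which at `X = e^t`
vanishes to order `M + 1` in `t` and so does not affect the moments in range. -/
theorem exists_moments {p : ℕ} [hp : Fact p.Prime] {c : ℕ} (hc : ¬ p ∣ c) (M : ℕ) :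
    ∃ W ∈ PrimeToSupport p, ∀ k, 1 ≤ k → k ≤ M + 1 →
      (c : ℚ) ^ (M + 1) * (((c : ℚ) ^ k - 1) * ((1 - (p : ℚ) ^ (k - 1)) * _root_.bernoulli k / k)) =
        W.sum fun j w => (w : ℚ) * (j : ℚ) ^ (k - 1) := by
  obtain ⟨Q, hQ, hL⟩ := exists_regularizedBernoulliSeries_mul hc
  have hp0 := hp.out.pos
  obtain ⟨H, hH⟩ : (X - 1 : ℤ[X]) ∣ (c : ℤ[X]) - ∑ i ∈ Finset.range c, X ^ i := by
    rw [← C_1, dvd_iff_isRoot]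
    simp
  set x : ℤ[X] := (X - 1) * H with hx
  set A : ℤ[X] := ∑ i ∈ Finset.range (M + 1), (c : ℤ[X]) ^ i * x ^ (M + 1 - 1 - i) with hA
  have hAD : A * (∑ i ∈ Finset.range c, X ^ i) = (c : ℤ[X]) ^ (M + 1) - x ^ (M + 1) := by
    have := (Commute.all (c : ℤ[X]) x).geom_sum₂_mul (M + 1)
    rw [← hA] at this
    rw [← this, ← hH]
    ring
  refine ⟨Q * expand ℤ p A, PrimeToSupport.mul_expand hQ hp0 A, fun k hk1 hkM => ?_⟩
  obtain ⟨m, rfl⟩ : ∃ m, k = m + 1 := ⟨k - 1, by omega⟩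
  have hfac : (m.factorial : ℚ) ≠ 0 := Nat.cast_ne_zero.mpr m.factorial_ne_zero
  have hXd : PowerSeries.X ∣ evalExp (X ^ p - 1) := by
    rw [PowerSeries.X_dvd_iff, map_sub, evalExp_X_pow, map_sub,
      ← PowerSeries.coeff_zero_eq_constantCoeff_apply, PowerSeries.coeff_rescale]
    simp
  have hmain : evalExp (Q * expand ℤ p A) = PowerSeries.C ((c : ℚ) ^ (M + 1)) *
      regularizedBernoulliSeries p c - regularizedBernoulliSeries p c *
        evalExp (expand ℤ p x) ^ (M + 1) := by
    have h1 := congrArg (fun P => evalExp (expand ℤ p P)) hAD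
    simp only [map_mul, map_sub, map_pow, map_natCast] at h1
    rw [map_mul, ← hL, mul_assoc, mul_comm (evalExp _) (evalExp _), h1]
    simp only [map_pow, map_natCast]
    ring
  have hdiv : PowerSeries.X ^ (M + 1) ∣ regularizedBernoulliSeries p c *
      evalExp (expand ℤ p x) ^ (M + 1) := by
    refine (pow_dvd_pow_of_dvd ?_ _).mul_left _
    rw [hx, map_mul, map_sub, expand_X, map_one, map_mul]
    exact hXd.mul_right _
  rw [add_tsub_cancel_right, ← coeff_evalExp, hmain, map_sub, PowerSeries.coeff_C_mul,
    PowerSeries.X_pow_dvd_iff.mp hdiv m (by omega), regularizedBernoulliSeries,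
    PowerSeries.coeff_mk, Nat.factorial_succ]
  push_cast
  field_simp
  ring

end

/-! ### Kummer congruences for Bernoulli numbers -/

section

variable {p : ℕ} [hp : Fact p.Prime]

theorem exists_kummerSeq_bernoulli {k₀ : ℕ} (hk₀ : 1 ≤ k₀)
    (hk : ¬ (p - 1) ∣ k₀) (r : ℕ) :
    ∃ b : ℕ → pIntegers p, KummerSeq (p : pIntegers p) r b ∧
      ∀ α, (b α : ℚ) = (1 - (p : ℚ) ^ (α * (p - 1) + k₀ - 1)) *
        bernoulli (α * (p - 1) + k₀) / (α * (p - 1) + k₀ : ℕ) := by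
  -- A generator of `(ℤ/p)ˣ` works, since its order `p - 1` does not divide `k₀`. The regularizing
  -- factor `c^k - 1` is then a unit for every weight in the family.
  obtain ⟨c, hc, hck⟩ : ∃ c : ℕ, ¬ p ∣ c ∧ ¬ (p : ℤ) ∣ (c : ℤ) ^ k₀ - 1 := by
    obtain ⟨g, hg⟩ := IsCyclic.exists_generator (α := (ZMod p)ˣ)
    have hval : (((g : ZMod p).val : ℕ) : ZMod p) = g := ZMod.natCast_zmod_val _
    refine ⟨(g : ZMod p).val, fun h => ?_, fun h => hk ?_⟩
    · rw [← ZMod.natCast_eq_zero_iff, hval] at h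
      exact g.ne_zero h
    · rw [← ZMod.intCast_zmod_eq_zero_iff_dvd] at h
      push_cast at h
      rw [hval, sub_eq_zero] at h
      have ho := orderOf_eq_card_of_forall_mem_zpowers hg
      rw [Nat.card_eq_fintype_card, ZMod.card_units] at ho
      rw [← ho]
      exact orderOf_dvd_of_pow_eq_one (Units.ext (by simpa using h))
  have hcu : IsUnit (c : pIntegers p) := pIntegers_isUnit_natCast hc
  have hck' : ∀ α, ¬ (p : ℤ) ∣ (c : ℤ) ^ (α * (p - 1) + k₀) - 1 := fun α h => hck ?_
  swap
  · have h1 : (p : ℤ) ∣ ((c : ℤ) ^ (p - 1)) ^ α - 1 :=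
      (p_dvd_pow_sub_one hc).trans (sub_one_dvd_pow_sub_one _ _)
    have : (c : ℤ) ^ k₀ - 1 = ((c : ℤ) ^ (α * (p - 1) + k₀) - 1) -
        (c : ℤ) ^ k₀ * (((c : ℤ) ^ (p - 1)) ^ α - 1) := by
      rw [pow_add, mul_comm α, pow_mul]; ring
    rw [this]
    exact dvd_sub h (h1.mul_left _)
  have hpow : ∀ {d : ℕ}, ¬ p ∣ d → ∀ s : ℕ,
      KummerSeq (p : pIntegers p) r fun α => (d : pIntegers p) ^ (α * (p - 1) + s) := by
    intro d hd s
    have := (KummerSeq.pow r (p_dvd_pow_sub_one hd (R := pIntegers p))).mul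
      (KummerSeq.const r ((d : pIntegers p) ^ s))
    refine cast (congrArg _ (funext fun α => ?_)) this
    rw [pow_add, mul_comm α, pow_mul]
  have hU : KummerSeq (p : pIntegers p) r fun α => (c : pIntegers p) ^ (α * (p - 1) + k₀) - 1 := by
    simpa only [sub_eq_add_neg] using (hpow hc k₀).add (KummerSeq.const r (-1))
  have hunit : ∀ α, IsUnit ((c : pIntegers p) ^ (α * (p - 1) + k₀) - 1) := fun α => by
    simpa using pIntegers_isUnit_intCast (hck' α)
  choose v hv using fun α => (hunit α).exists_right_inv
  obtain ⟨u, hu⟩ := hcu.exists_right_inv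
  have hV := hU.inverse hv
  have key : ∀ N, ∃ b : ℕ → pIntegers p, KummerSeq (p : pIntegers p) r b ∧
      ∀ α ≤ N, (b α : ℚ) = (1 - (p : ℚ) ^ (α * (p - 1) + k₀ - 1)) *
        bernoulli (α * (p - 1) + k₀) / (α * (p - 1) + k₀ : ℕ) := by
    intro N
    obtain ⟨W, hW, hWk⟩ := exists_moments hc (N * (p - 1) + k₀)
    refine ⟨fun α => (u ^ (N * (p - 1) + k₀ + 1) * v α) * ∑ j ∈ W.support,
      (W.coeff j : pIntegers p) * (j : pIntegers p) ^ (α * (p - 1) + (k₀ - 1)),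
      ((KummerSeq.const r _).mul hV).mul (KummerSeq.sum _ fun j hj =>
        (KummerSeq.const r _).mul (hpow ?_ _)), fun α hα => ?_⟩
    · rintro ⟨i, rfl⟩
      exact Polynomial.mem_support_iff.mp hj (hW i)
    · have hle : α * (p - 1) ≤ N * (p - 1) := Nat.mul_le_mul_right _ hα
      have h := hWk (α * (p - 1) + k₀) (by omega) (by omega)
      have h1 := congrArg (Subtype.val) (hv α)
      have h2 := congrArg (fun x : pIntegers p => (x : ℚ) ^ (N * (p - 1) + k₀ + 1)) hu
      simp only [Subring.coe_mul, AddSubgroupClass.coe_sub, Subring.coe_pow, Subring.coe_one, one_pow,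
        Subring.coe_natCast, mul_pow] at h1 h2
      have hs : ((∑ j ∈ W.support, (W.coeff j : pIntegers p) *
          (j : pIntegers p) ^ (α * (p - 1) + (k₀ - 1)) : pIntegers p) : ℚ) =
          W.sum fun j w => (w : ℚ) * (j : ℚ) ^ (α * (p - 1) + k₀ - 1) := by
        rw [Polynomial.sum, Nat.add_sub_assoc hk₀]
        push_cast
        rfl
      simp only [Subring.coe_mul, Subring.coe_pow]
      rw [hs, ← h]
      linear_combination ((1 - (p : ℚ) ^ (α * (p - 1) + k₀ - 1)) *
        bernoulli (α * (p - 1) + k₀) / (α * (p - 1) + k₀ : ℕ)) *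
        ((((c : ℚ) ^ (α * (p - 1) + k₀) - 1) * (v α : ℚ)) * h2 + h1)
  choose b hb hbv using key
  -- The values are forced by the Bernoulli formula, so the diagonal agrees with every `b N` on its
  -- range.
  refine ⟨fun α => b α α, KummerSeq.of_local pIntegers_p_ne_zero fun N =>
    ⟨b N, hb N, fun n hn => Subtype.ext ?_⟩, fun α => hbv α α le_rfl⟩
  rw [hbv N n hn, hbv n n le_rfl]

end

/-! ### The Serre derivative on `q`-expansions -/

section

open UpperHalfPlane hiding I
open scoped Manifold ModularForm
open Complex Derivative Function

/-- With `F(τ) = Φ(q)` the chain rule gives the normalized derivative as `q Φ'(q)`; then `Φ'` is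
expanded in its Taylor series. -/
theorem hasSum_normalizedDerivOfComplex {F : ℍ → ℂ} (hper : Periodic (F ∘ ofComplex) 1)
    (hhol : MDiff F) (hbdd : IsBoundedAtImInfty F) (τ : ℍ) :
    HasSum (fun m : ℕ => ((m : ℂ) * (qExpansion 1 F).coeff m) • Periodic.qParam 1 τ ^ m)
      (normalizedDerivOfComplex F τ) := by
  have hper' : Periodic (F ∘ ofComplex) (1 : ℝ) := by simpa using hper
  set Φ := cuspFunction 1 F with hΦ₀
  set q := Periodic.qParam 1 (τ : ℂ) with hq
  have hqn : ‖q‖ < 1 := Periodic.norm_qParam_lt_one one_pos τ.im_pos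
  have hdiff := differentiableOn_cuspFunction_ball one_pos hper' hhol hbdd
  have hderiv : DifferentiableOn ℂ (deriv Φ) (Metric.ball 0 1) := hdiff.deriv Metric.isOpen_ball
  have hsum := hasSum_taylorSeries_on_ball hderiv (z := q) (by simpa using hqn)
  have hval : normalizedDerivOfComplex F τ = q * deriv Φ q := by
    have hev : (F ∘ ofComplex) =ᶠ[nhds (τ : ℂ)] fun z => Φ (Periodic.qParam 1 z) := by
      filter_upwards [isOpen_upperHalfPlaneSet.mem_nhds τ.im_pos] with z hz
      have := eq_cuspFunction (h := 1) (f := F) ⟨z, hz⟩ one_ne_zero hper'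
      simpa [ofComplex_apply_of_im_pos hz] using this.symm
    have hΦ : HasDerivAt Φ (deriv Φ q) q :=
      (hdiff.differentiableAt (Metric.isOpen_ball.mem_nhds (by simpa using hqn))).hasDerivAt
    have hqd : HasDerivAt (fun z => Periodic.qParam 1 z) (q * (2 * Real.pi * I)) (τ : ℂ) := by
      have := ((hasDerivAt_id (τ : ℂ)).const_mul (2 * Real.pi * I)).cexp
      simpa [hq, Periodic.qParam] using this
    have hcomp : HasDerivAt (fun z => Φ (Periodic.qParam 1 z)) (deriv Φ q * (q * (2 * Real.pi * I)))
      (τ : ℂ) := hΦ.comp (τ : ℂ) hqd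
    rw [normalizedDerivOfComplex, hev.deriv_eq, hcomp.deriv]
    field
  rw [hval, ← hasSum_nat_add_iff' 1]
  simp only [Finset.range_one, Finset.sum_singleton, Nat.cast_zero, zero_mul, zero_smul, sub_zero]
  refine (hsum.mul_left q).congr_fun fun m => ?_
  rw [qExpansion_coeff, iteratedDeriv_succ', Nat.factorial_succ]
  have h0 : (m.factorial : ℂ) ≠ 0 := Nat.cast_ne_zero.mpr m.factorial_ne_zero
  simp only [smul_eq_mul, sub_zero]
  push_cast
  rw [hΦ₀]
  field_simp
  ring

/-- The series `E_2` over `ℂ`. -/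
noncomputable def e2Series : PowerSeries ℂ :=
  PowerSeries.mk fun m => if m = 0 then 1 else -24 * (ArithmeticFunction.sigma 1 m : ℂ)

theorem hasSum_E2_mul {F : ℍ → ℂ} (hper : Periodic (F ∘ ofComplex) 1)
    (hhol : MDiff F) (hbdd : IsBoundedAtImInfty F) (τ : ℍ) :
    HasSum (fun m : ℕ => (e2Series * qExpansion 1 F).coeff m • Periodic.qParam 1 τ ^ m)
      (EisensteinSeries.E2 τ * F τ) := by
  have hper' : Periodic (F ∘ ofComplex) (1 : ℝ) := by simpa using hper
  have hq : cexp (2 * Real.pi * I * τ) = Periodic.qParam 1 τ := by simp [Periodic.qParam]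
  have h1 : HasSum (fun m : ℕ => e2Series.coeff m • Periodic.qParam 1 τ ^ m)
      (EisensteinSeries.E2 τ) := by
    simpa [e2Series, hq] using EisensteinSeries.hasSum_qExpansion_E2 (z := τ)
  have h2 := hasSum_qExpansion one_pos hper' hhol hbdd τ
  have hn := h1.summable.norm
  have hn' := h2.summable.norm
  have h3 := tsum_mul_tsum_eq_tsum_sum_antidiagonal_of_summable_norm hn hn'
  rw [h1.tsum_eq, h2.tsum_eq] at h3
  rw [h3]
  refine (summable_norm_sum_mul_antidiagonal_of_summable_norm hn hn').of_norm.hasSum.congr_fun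
    fun m => ?_
  rw [PowerSeries.coeff_mul, Finset.sum_smul]
  refine Finset.sum_congr rfl fun x hx => ?_
  rw [← Finset.HasAntidiagonal.mem_antidiagonal.mp hx, pow_add]
  simp only [smul_eq_mul]
  ring

theorem exists_serreDerivative {k : ℤ} (F : ModularForm 𝒮ℒ k) :
    ∃ G : ModularForm 𝒮ℒ (k + 2), ∀ m, (qExpansion 1 G).coeff m =
      (m : ℂ) * (qExpansion 1 F).coeff m -
        (k : ℂ) * 12⁻¹ * (e2Series * qExpansion 1 F).coeff m := by
  have hper : Periodic (F ∘ ofComplex) 1 := by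
    simpa using SlashInvariantFormClass.periodic_comp_ofComplex F (h := 1) one_mem_strictPeriods_SL
  have hhol : MDiff F := ModularFormClass.holo F
  have hbdd : IsBoundedAtImInfty F := ModularFormClass.bdd_at_infty F
  have hsum : ∀ τ : ℍ, HasSum (fun m : ℕ => ((m : ℂ) * (qExpansion 1 F).coeff m -
      (k : ℂ) * 12⁻¹ * (e2Series * qExpansion 1 F).coeff m) • Periodic.qParam 1 τ ^ m)
      (serreDerivative k F τ) := fun τ => by
    have := (hasSum_normalizedDerivOfComplex hper hhol hbdd τ).sub
      ((hasSum_E2_mul hper hhol hbdd τ).mul_left ((k : ℂ) * 12⁻¹))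
    rw [serreDerivative_apply, mul_assoc]
    refine this.congr_fun fun m => ?_
    simp only [smul_eq_mul]
    ring
  have hslash : ∀ γ : SL(2, ℤ), serreDerivative k F ∣[k + 2] γ = serreDerivative k F := fun γ =>
    serreDerivative_slash_invariant hhol (SlashInvariantFormClass.slash_action_eq F _ ⟨γ, rfl⟩)
  have hb := isBoundedAtImInfty_of_hasSum_qExpansion one_pos hsum
  let G : ModularForm 𝒮ℒ (k + 2) :=
    { toFun := serreDerivative k F
      slash_action_eq' := by
        rintro A ⟨γ, rfl⟩
        exact hslash γ
      holo' := serreDerivative_mdifferentiable k hhol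
      bdd_at_cusps' := fun {c} hc => by
        rw [Subgroup.IsArithmetic.isCusp_iff_isCusp_SL2Z] at hc
        rw [OnePoint.isBoundedAt_iff_forall_SL2Z hc]
        intro γ _
        rw [hslash γ]
        exact hb }
  exact ⟨G, fun m => (ModularFormClass.qExpansion_coeff_unique one_pos one_mem_strictPeriods_SL
    (f := G) hsum m).symm⟩

end

/-! ### Modular forms with `p`-integral coefficients and the lift of `E_{p-1}` -/

section

open UpperHalfPlane hiding I

variable {p : ℕ} [hp : Fact p.Prime]

/-- The inclusion of the `p`-integral rationals into the complex numbers. -/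
noncomputable def pIntegersToComplex (p : ℕ) [Fact p.Prime] : pIntegers p →+* ℂ :=
  (algebraMap ℚ ℂ).comp (pIntegers p).subtype

theorem pIntegersToComplex_apply (x : pIntegers p) : pIntegersToComplex p x = ((x : ℚ) : ℂ) := rfl

/-- A `q`-series with `p`-integral coefficients is the `q`-expansion of a level one modular form of
weight `w`. -/
def IsModularSeries (w : ℕ) (f : PowerSeries (pIntegers p)) : Prop :=
  ∃ F : ModularForm 𝒮ℒ (w : ℤ), qExpansion 1 F = PowerSeries.map (pIntegersToComplex p) f

namespace IsModularSeries

theorem add {w : ℕ} {f g : PowerSeries (pIntegers p)} (hf : IsModularSeries w f)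
    (hg : IsModularSeries w g) : IsModularSeries w (f + g) := by
  obtain ⟨F, hF⟩ := hf
  obtain ⟨G, hG⟩ := hg
  refine ⟨F + G, ?_⟩
  rw [map_add, ← hF, ← hG]
  exact ModularForm.qExpansion_add one_pos one_mem_strictPeriods_SL F G

theorem C_mul {w : ℕ} {f : PowerSeries (pIntegers p)} (hf : IsModularSeries w f)
    (c : pIntegers p) : IsModularSeries w (PowerSeries.C c * f) := by
  obtain ⟨F, hF⟩ := hf
  refine ⟨pIntegersToComplex p c • F, ?_⟩
  rw [map_mul, ← hF, PowerSeries.map_C, ← PowerSeries.smul_eq_C_mul]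
  exact ModularForm.qExpansion_smul one_pos one_mem_strictPeriods_SL _ F

theorem intCast_mul {w : ℕ} {f : PowerSeries (pIntegers p)} (hf : IsModularSeries w f)
    (c : ℤ) : IsModularSeries w ((c : PowerSeries (pIntegers p)) * f) := by
  simpa using hf.C_mul (c : pIntegers p)

theorem mul {w₁ w₂ : ℕ} {f g : PowerSeries (pIntegers p)} (hf : IsModularSeries w₁ f)
    (hg : IsModularSeries w₂ g) : IsModularSeries (w₁ + w₂) (f * g) := by
  obtain ⟨F, hF⟩ := hf
  obtain ⟨G, hG⟩ := hg
  refine ⟨ModularForm.mcast (by push_cast; rfl) (F.mul G), ?_⟩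
  rw [map_mul, ← hF, ← hG, ModularForm.qExpansion_mcast _ rfl]
  exact ModularForm.qExpansion_mul one_pos one_mem_strictPeriods_SL F G

theorem pow_mul {w w' : ℕ} {E f : PowerSeries (pIntegers p)} (hE : IsModularSeries w' E)
    (hf : IsModularSeries w f) (n : ℕ) : IsModularSeries (n * w' + w) (E ^ n * f) := by
  induction n with
  | zero => simpa using hf
  | succ n ih =>
    have := hE.mul ih
    rwa [← mul_assoc, ← pow_succ', ← add_assoc, add_comm w', ← Nat.succ_mul] at this

end IsModularSeries

theorem factorFiltration_le {m w n : ℕ} {f g E : PowerSeries (pIntegers p)}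
    (hE : PowerSeries.map (pIntegers p).subtype E = eisensteinE (p - 1))
    (hg : IsModularSeries w g) (h : (p : PowerSeries (pIntegers p)) ^ m ∣ f - E ^ n * g) :
    factorFiltration p m (PowerSeries.map (pIntegers p).subtype f) ≤ w := by
  refine sInf_le ⟨w, n, PowerSeries.map (pIntegers p).subtype g, rfl, ⟨fun i => ?_, ?_⟩,
    fun i => ?_⟩
  · rw [PowerSeries.coeff_map]
    exact (PowerSeries.coeff i g).2
  · obtain ⟨F, hF⟩ := hg
    refine ⟨F, hF.trans ?_⟩
    ext i
    simp [pIntegersToComplex_apply]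
  · obtain ⟨c, hc⟩ := natCast_pow_dvd_powerSeries_iff.mp h i
    refine ⟨c, c.2, ?_⟩
    rw [← hE, ← map_pow, ← map_mul, ← map_sub, ← map_sub, PowerSeries.coeff_map, hc]
    simp

theorem factorFiltration_le_weight {m w : ℕ} {f E : PowerSeries (pIntegers p)}
    (hE : PowerSeries.map (pIntegers p).subtype E = eisensteinE (p - 1))
    (hf : IsModularSeries w f) :
    factorFiltration p m (PowerSeries.map (pIntegers p).subtype f) ≤ w :=
  factorFiltration_le (n := 0) hE hf (by simp)

theorem bernoulli_ne_zero {k : ℕ} (hk : 2 ≤ k) (hk2 : Even k) : bernoulli k ≠ 0 := by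
  obtain ⟨m, rfl⟩ := even_iff_exists_two_mul.mp hk2
  intro h
  have hz := riemannZeta_two_mul_nat (k := m) (by omega)
  rw [h] at hz
  refine riemannZeta_ne_zero_of_one_lt_re (s := 2 * m) ?_ (by simpa using hz)
  have : (1 : ℝ) ≤ m := by exact_mod_cast (by omega : 1 ≤ m)
  simp
  linarith

theorem qExpansion_eisenstein {k : ℕ} (hk : 3 ≤ k) (hk2 : Even k) :
    qExpansion 1 (ModularForm.E hk) = PowerSeries.map (algebraMap ℚ ℂ) (eisensteinE k) := by
  ext n
  rw [EisensteinSeries.E_qExpansion_coeff hk hk2, PowerSeries.coeff_map, eisensteinE,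
    PowerSeries.coeff_mk]
  split_ifs <;> simp

theorem eisensteinG_eq {k : ℕ} (hk : 2 ≤ k) (hk2 : Even k) :
    eisensteinG k = PowerSeries.C (-(bernoulli k) / (2 * (k : ℚ))) * eisensteinE k := by
  have h1 := bernoulli_ne_zero hk hk2
  have h2 : (k : ℚ) ≠ 0 := Nat.cast_ne_zero.mpr (by omega)
  ext n
  rw [PowerSeries.coeff_C_mul, eisensteinG, eisensteinE, PowerSeries.coeff_mk, PowerSeries.coeff_mk]
  split_ifs
  · simp
  · field_simp

theorem isModularSeries_of_eisensteinE {k : ℕ} (hk : 3 ≤ k) (hk2 : Even k)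
    {f : PowerSeries (pIntegers p)}
    (hf : PowerSeries.map (pIntegers p).subtype f = eisensteinE k) : IsModularSeries k f := by
  refine ⟨ModularForm.E hk, ?_⟩
  rw [qExpansion_eisenstein hk hk2, ← hf]
  ext n
  simp [pIntegersToComplex_apply]

theorem isModularSeries_of_eisensteinG {k : ℕ} (hk : 3 ≤ k) (hk2 : Even k)
    {f : PowerSeries (pIntegers p)}
    (hf : PowerSeries.map (pIntegers p).subtype f = eisensteinG k) : IsModularSeries k f := by
  refine ⟨((-(bernoulli k) / (2 * (k : ℚ)) : ℚ) : ℂ) • ModularForm.E hk, ?_⟩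
  refine (ModularForm.qExpansion_smul one_pos one_mem_strictPeriods_SL _
    (ModularForm.E hk)).trans ?_
  have hc : PowerSeries.map (pIntegersToComplex p) f =
      PowerSeries.map (algebraMap ℚ ℂ) (eisensteinG k) := by
    rw [← hf]
    ext n
    simp [pIntegersToComplex_apply]
  rw [qExpansion_eisenstein hk hk2, hc, eisensteinG_eq (by omega) hk2, map_mul, PowerSeries.map_C,
    PowerSeries.smul_eq_C_mul]
  rfl

/-- By von Staudt–Clausen, `1/p` is the only summand of the correction to `B_{p-1}` that is not
`p`-integral. -/
theorem exists_p_mul_bernoulli_add_one (hp5 : 5 ≤ p) :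
    ∃ x : pIntegers p, (p : ℚ) * bernoulli (p - 1) + 1 = p * x := by
  have hodd := hp.out.odd_of_ne_two (by omega)
  obtain ⟨m, hm⟩ := hodd
  have hpm : p - 1 = 2 * m := by omega
  have h := Bernoulli.vonStaudt_clausen m
  rw [← hpm] at h
  obtain ⟨z, hz⟩ := h
  have hmem : p ∈ {q ∈ Finset.range (p - 1 + 2) | q.Prime ∧ (q - 1) ∣ p - 1} := by
    simp [hp.out]; omega
  rw [← Finset.add_sum_erase _ _ hmem] at hz
  have hsum : ∑ q ∈ {q ∈ Finset.range (p - 1 + 2) | q.Prime ∧ (q - 1) ∣ p - 1}.erase p,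
      (1 : ℚ) / q ∈ pIntegers p := by
    refine Subring.sum_mem _ fun q hq => ?_
    simp only [Finset.mem_erase, Finset.mem_filter] at hq
    have := inv_intCast_mem_pIntegers (p := p) (m := q) fun hd =>
      hq.1 ((Nat.prime_dvd_prime_iff_eq hp.out hq.2.2.1).mp (by exact_mod_cast hd)).symm
    simpa using this
  refine ⟨⟨z, intCast_mem _ z⟩ - ⟨_, hsum⟩, ?_⟩
  have hp0 : (p : ℚ) ≠ 0 := Nat.cast_ne_zero.mpr hp.out.ne_zero
  simp only [AddSubgroupClass.coe_sub]
  rw [hz]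
  field_simp
  ring

/-- The `p`-integral lift of `E_{p-1}`; here `μ = -1 / (p * B_{p-1})`. -/
theorem exists_eisensteinE_lift (hp5 : 5 ≤ p) :
    ∃ (E : PowerSeries (pIntegers p)) (μ : pIntegers p),
      PowerSeries.map (pIntegers p).subtype E = eisensteinE (p - 1) ∧
      (p : pIntegers p) ∣ μ - 1 ∧ ∀ n, PowerSeries.coeff n E = if n = 0 then 1 else
        (p : pIntegers p) * (2 * (p - 1 : ℕ) * μ * (ArithmeticFunction.sigma (p - 2) n : ℕ)) := by
  obtain ⟨x, hx⟩ := exists_p_mul_bernoulli_add_one hp5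
  -- This is `p B_{p-1}`, a unit because it is `-1` modulo `p`; hence `1/B_{p-1}` is `p` times a
  -- unit.
  set y : pIntegers p := p * x - 1 with hy
  have hyv : (y : ℚ) = p * bernoulli (p - 1) := by
    rw [hy]; push_cast; linarith
  have hyu : IsUnit y := pIntegers_isUnit_of_not_dvd fun h => by
    have h1 : (p : pIntegers p) ∣ ((-1 : ℤ) : pIntegers p) := by
      have := dvd_sub h (dvd_mul_right (p : pIntegers p) x)
      simpa [hy] using this
    obtain ⟨z, hz⟩ := h1
    have hzq : ((-1 : ℤ) : ℚ) = p * (z : ℚ) := by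
      have := congrArg Subtype.val hz
      simpa using this
    have hp0 : (p : ℚ) ≠ 0 := Nat.cast_ne_zero.mpr hp.out.ne_zero
    have hinv : (p : ℚ)⁻¹ ∈ pIntegers p := by
      have : (p : ℚ)⁻¹ = -(z : ℚ) := by
        field_simp
        push_cast at hzq
        linarith
      rw [this]
      exact neg_mem z.2
    exact hinv (by rw [Rat.inv_natCast_den_of_pos hp.out.pos])
  obtain ⟨v, hv⟩ := hyu.exists_right_inv
  have hvq : (y : ℚ) * (v : ℚ) = 1 := by
    simpa using congrArg Subtype.val hv
  have hB := bernoulli_ne_zero (k := p - 1) (by omega)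
    (by have := hp.out.odd_of_ne_two (by omega); grind)
  refine ⟨PowerSeries.mk fun n => if n = 0 then 1 else
        (p : pIntegers p) * (2 * (p - 1 : ℕ) * (-v) * (ArithmeticFunction.sigma (p - 2) n : ℕ)), -v,
        ?_, ⟨-(x * v), by linear_combination hv - v * hy⟩, fun n => by simp⟩
  ext n
  rw [PowerSeries.coeff_map, PowerSeries.coeff_mk, eisensteinE, PowerSeries.coeff_mk]
  split_ifs
  · simp
  · rw [show p - 1 - 1 = p - 2 by omega]
    have hvv : (p : ℚ) * (v : ℚ) = (bernoulli (p - 1))⁻¹ := by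
      rw [hyv] at hvq
      field_simp
      linarith
    simp only [Subring.subtype_apply, Subring.coe_mul, Subring.coe_natCast, NegMemClass.coe_neg,
      show ((2 : pIntegers p) : ℚ) = 2 from rfl]
    linear_combination (-2 * ((p - 1 : ℕ) : ℚ) * (ArithmeticFunction.sigma (p - 2) n : ℕ)) * hvv

end

/-! ### Divisor sums and the interpolated Eisenstein family -/

/-- The `p`-deprived divisor power sum. -/
def sigmaStar (p s n : ℕ) : ℕ := ∑ d ∈ n.divisors with ¬ p ∣ d, d ^ s

theorem sigma_eq_sigmaStar_add {p : ℕ} (s n : ℕ) :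
    ArithmeticFunction.sigma s n = sigmaStar p s n + ∑ d ∈ n.divisors with p ∣ d, d ^ s := by
  rw [ArithmeticFunction.sigma_apply, sigmaStar, add_comm, Finset.sum_filter_add_sum_filter_not]

theorem pow_dvd_sigma_sub_sigmaStar {p : ℕ} {R : Type*} [CommRing R] (s n : ℕ) :
    (p : R) ^ s ∣ (ArithmeticFunction.sigma s n : ℕ) - (sigmaStar p s n : ℕ) := by
  rw [sigma_eq_sigmaStar_add (p := p), Nat.cast_add, add_sub_cancel_left, Nat.cast_sum]
  refine Finset.dvd_sum fun d hd => ?_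
  rw [← Nat.cast_pow]
  exact Nat.cast_dvd_cast (pow_dvd_pow_of_dvd (Finset.mem_filter.mp hd).2 s)

section

variable {p : ℕ} [hp : Fact p.Prime]

theorem mul_sum_div_eq {n : ℕ} :
    p * ∑ d ∈ n.divisors with p ∣ d, n / d = ∑ d ∈ n.divisors with p ∣ d, d := by
  have hp0 := hp.out.pos
  by_cases hpn : p ∣ n
  · obtain ⟨m, rfl⟩ := hpn
    rcases Nat.eq_zero_or_pos m with rfl | hm
    · simp
    have hsum : ∀ g : ℕ → ℕ, ∑ d ∈ (p * m).divisors with p ∣ d, g d =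
        ∑ d ∈ m.divisors, g (p * d) := fun g => by
      symm
      refine Finset.sum_bij (fun d _ => p * d) (fun d hd => ?_) (fun a _ b _ h =>
        Nat.eq_of_mul_eq_mul_left hp0 h) (fun d hd => ?_) fun _ _ => rfl
      · rw [Nat.mem_divisors] at hd
        simp [hd.1, Nat.mul_dvd_mul_left, hp0.ne', hm.ne']
      · simp only [Finset.mem_filter, Nat.mem_divisors] at hd
        obtain ⟨⟨h1, -⟩, e, rfl⟩ := hd
        exact ⟨e, Nat.mem_divisors.mpr ⟨Nat.dvd_of_mul_dvd_mul_left hp0 h1, hm.ne'⟩, rfl⟩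
    rw [hsum, hsum, ← Finset.mul_sum]
    simp only [Nat.mul_div_mul_left _ _ hp0]
    rw [Nat.sum_div_divisors m fun d => d]
  · have : n.divisors.filter (p ∣ ·) = ∅ :=
      Finset.filter_eq_empty_iff.mpr fun d hd h => hpn (h.trans (Nat.dvd_of_mem_divisors hd))
    rw [this]
    simp

/-- The sum of the complementary divisors `n / d` over the divisors `d` of `n` prime to `p`. -/
def sigmaCompl (p n : ℕ) : ℕ := ∑ d ∈ n.divisors with ¬ p ∣ d, n / d

/-- Coefficient form of `G_2* = G_2 - p (G_2 - T)`, where `T` has coefficients `sigmaCompl p n`. -/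
theorem sigmaStar_one_add (n : ℕ) :
    sigmaStar p 1 n + p * ArithmeticFunction.sigma 1 n =
      ArithmeticFunction.sigma 1 n + p * sigmaCompl p n := by
  have h1 := sigma_eq_sigmaStar_add (p := p) 1 n
  have h2 : ArithmeticFunction.sigma 1 n = sigmaCompl p n +
      ∑ d ∈ n.divisors with p ∣ d, n / d := by
    rw [sigmaCompl, add_comm, Finset.sum_filter_add_sum_filter_not,
      Nat.sum_div_divisors n fun d => d, ArithmeticFunction.sigma_one_apply]
  have h3 := mul_sum_div_eq (p := p) (n := n)
  simp only [pow_one] at h1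
  nth_rewrite 1 [h2]
  rw [mul_add, h3, h1]
  ring

/-- Write `n σ_{p-2}(n) = ∑ (n/d) d^(p-1)` and apply Fermat: terms with `p ∣ d` vanish mod `p`, the
others become `n/d`. This identifies the `q`-derivative of `E_{p-1}` modulo `p²`. -/
theorem dvd_mul_sigma_sub_sigmaCompl (hp2 : 2 ≤ p) {R : Type*} [CommRing R] (n : ℕ) :
    (p : R) ∣ (n : R) * (ArithmeticFunction.sigma (p - 2) n : ℕ) - (sigmaCompl p n : ℕ) := by
  have h : (n : R) * (ArithmeticFunction.sigma (p - 2) n : ℕ) =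
      ∑ d ∈ n.divisors, ((n / d : ℕ) : R) * (d : R) ^ (p - 1) := by
    rw [ArithmeticFunction.sigma_apply, Nat.cast_sum, Finset.mul_sum]
    refine Finset.sum_congr rfl fun d hd => ?_
    have h1 : n / d * d = n := Nat.div_mul_cancel (Nat.dvd_of_mem_divisors hd)
    have h2 : p - 1 = (p - 2) + 1 := by omega
    nth_rewrite 1 [← h1]
    rw [h2]
    push_cast
    ring
  rw [h, sigmaCompl, Nat.cast_sum, ← Finset.sum_filter_add_sum_filter_not _ (p ∣ ·), add_sub_assoc,
    ← Finset.sum_sub_distrib]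
  refine dvd_add (Finset.dvd_sum fun d hd => ?_) (Finset.dvd_sum fun d hd => ?_)
  · have : (p : R) ∣ (d : R) := Nat.cast_dvd_cast (Finset.mem_filter.mp hd).2
    exact ((dvd_pow_self _ (by omega)).trans (pow_dvd_pow_of_dvd this (p - 1))).mul_left _
  · have := p_dvd_pow_sub_one (Finset.mem_filter.mp hd).2 (R := R)
    rw [← mul_sub_one]
    exact this.mul_left _

/-- The weights `α * (p - 1) + k₀`. -/
def famWeight (p k₀ α : ℕ) : ℕ := α * (p - 1) + k₀

/-- The data of the Eisenstein family of weights `α * (p - 1) + k₀`: the Eisenstein series `f α`,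
their `p`-deprived versions `fs α`, and `p`-adically interpolated quotients `F α`. -/
structure EisensteinFamily (p : ℕ) [Fact p.Prime] (k₀ : ℕ) (E : PowerSeries (pIntegers p)) where
  f : ℕ → PowerSeries (pIntegers p)
  fs : ℕ → PowerSeries (pIntegers p)
  F : ℕ → PowerSeries (pIntegers p)
  map_f : ∀ α, PowerSeries.map (pIntegers p).subtype (f α) = eisensteinG (famWeight p k₀ α)
  dvd_f_sub_fs : ∀ α, (p : PowerSeries (pIntegers p)) ^ (famWeight p k₀ α - 1) ∣ f α - fs α
  coeff_fs : ∀ α n, n ≠ 0 → PowerSeries.coeff n (fs α) = (sigmaStar p (famWeight p k₀ α - 1) n : ℕ)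
  coeff_fs_zero : ∀ α, PowerSeries.coeff 0 (fs α) =
    (1 - (p : pIntegers p) ^ (famWeight p k₀ α - 1)) * PowerSeries.coeff 0 (f α)
  kummer : KummerSeq (p : PowerSeries (pIntegers p)) 4 F
  fs_eq : ∀ α, fs α = E ^ α * F α

theorem exists_eisensteinFamily (hp5 : 5 ≤ p) {k₀ : ℕ} (hk₀ : 2 ≤ k₀) (hk₀' : k₀ ≤ p - 3)
    {E : PowerSeries (pIntegers p)} (hE : (p : PowerSeries (pIntegers p)) ∣ E - 1)
    (hEu : PowerSeries.coeff 0 E = 1) : Nonempty (EisensteinFamily p k₀ E) := by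
  obtain ⟨b, hb, hbv⟩ := exists_kummerSeq_bernoulli (p := p) (k₀ := k₀) (by omega)
    (fun h => by have := Nat.le_of_dvd (by omega) h; omega) 4
  obtain ⟨h2, hh2⟩ := (pIntegers_isUnit_natCast (p := p) (m := 2) fun h => by
    have := Nat.le_of_dvd (by omega) h; omega).exists_right_inv
  have hh2q : (2 : ℚ) * (h2 : ℚ) = 1 := congrArg Subtype.val hh2
  have hpk : ∀ α, ¬ (p : pIntegers p) ∣ 1 - (p : pIntegers p) ^ (famWeight p k₀ α - 1) := by
    intro α h
    have h1 : (p : pIntegers p) ∣ 1 := by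
      have := dvd_add h (dvd_pow_self (p : pIntegers p)
        (show famWeight p k₀ α - 1 ≠ 0 by unfold famWeight; omega))
      simpa using this
    obtain ⟨z, hz⟩ := h1
    have hzq : 1 = (p : ℚ) * (z : ℚ) := by simpa using congrArg Subtype.val hz
    have hinv : (p : ℚ)⁻¹ ∈ pIntegers p := by
      rw [← eq_inv_of_mul_eq_one_right hzq.symm]
      exact z.2
    exact hinv (by rw [Rat.inv_natCast_den_of_pos hp.out.pos])
  choose v hv using fun α => (pIntegers_isUnit_of_not_dvd (hpk α)).exists_right_inv
  have hvq : ∀ α, (1 - (p : ℚ) ^ (famWeight p k₀ α - 1)) * (v α : ℚ) = 1 := fun α => by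
    simpa using congrArg Subtype.val (hv α)
  obtain ⟨E', hE'⟩ : ∃ E', E * E' = 1 := by
    refine (PowerSeries.isUnit_iff_constantCoeff.mpr ?_).exists_right_inv
    rw [← PowerSeries.coeff_zero_eq_constantCoeff_apply, hEu]
    exact isUnit_one
  -- `b α` carries the Euler factor `1 - p^(k-1)`, `h2` is `1/2`, and `v α` below inverts the Euler
  -- factor to recover the constant term of `G_k`.
  set fs : ℕ → PowerSeries (pIntegers p) := fun α => PowerSeries.mk fun n =>
    if n = 0 then -(b α * h2) else (sigmaStar p (famWeight p k₀ α - 1) n : ℕ) with hfs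
  set f : ℕ → PowerSeries (pIntegers p) := fun α => PowerSeries.mk fun n =>
    if n = 0 then -(v α * b α * h2) else
      (ArithmeticFunction.sigma (famWeight p k₀ α - 1) n : ℕ) with hf
  have hkum : KummerSeq (p : PowerSeries (pIntegers p)) 4 fs := by
    rw [← map_natCast PowerSeries.C]
    refine KummerSeq.powerSeries fun m => ?_
    simp only [hfs, PowerSeries.coeff_mk]
    split_ifs
    · simpa [mul_comm] using hb.mul (KummerSeq.const 4 (-h2))
    · simp only [sigmaStar, Nat.cast_sum, Nat.cast_pow]
      refine KummerSeq.sum _ fun d hd => ?_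
      have := (KummerSeq.pow 4 (p_dvd_pow_sub_one (Finset.mem_filter.mp hd).2
        (R := pIntegers p))).mul (KummerSeq.const 4 ((d : pIntegers p) ^ (k₀ - 1)))
      refine cast (congrArg _ (funext fun α => ?_)) this
      rw [famWeight, Nat.add_sub_assoc (by omega), pow_add, mul_comm α, pow_mul]
  have hE1 : (p : PowerSeries (pIntegers p)) ∣ E' - 1 := by
    have : E' - 1 = -(E' * (E - 1)) := by linear_combination hE'
    rw [this]
    exact (hE.mul_left _).neg_right
  refine ⟨⟨f, fs, fun α => E' ^ α * fs α, fun α => ?_, fun α => ?_, fun α n hn => ?_, fun α => ?_,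
    (KummerSeq.pow 4 hE1).mul hkum, fun α => ?_⟩⟩
  · ext n
    rw [PowerSeries.coeff_map, eisensteinG, PowerSeries.coeff_mk, PowerSeries.coeff_mk]
    split_ifs
    · have h0 : ((famWeight p k₀ α : ℕ) : ℚ) ≠ 0 :=
        Nat.cast_ne_zero.mpr (by unfold famWeight; omega)
      simp only [Subring.subtype_apply, NegMemClass.coe_neg, Subring.coe_mul]
      have hb' : (b α : ℚ) = (1 - (p : ℚ) ^ (famWeight p k₀ α - 1)) *
        bernoulli (famWeight p k₀ α) / (famWeight p k₀ α : ℕ) := hbv α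
      rw [hb', eq_div_iff (by positivity)]
      field_simp
      linear_combination (-bernoulli (famWeight p k₀ α)) * (hvq α) -
        bernoulli (famWeight p k₀ α) * (1 - (p : ℚ) ^ (famWeight p k₀ α - 1)) * (v α : ℚ) * hh2q
    · simp
  · rw [natCast_pow_dvd_powerSeries_iff]
    intro n
    rw [map_sub, PowerSeries.coeff_mk, PowerSeries.coeff_mk]
    split_ifs
    · exact ⟨-(v α * b α * h2), by linear_combination (-b α * h2) * hv α⟩
    · exact pow_dvd_sigma_sub_sigmaStar _ _
  · simp [hfs, hn]
  · simp only [hfs, hf, PowerSeries.coeff_mk, ↓reduceIte]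
    linear_combination (b α * h2) * hv α
  · rw [← mul_assoc, ← mul_pow, hE', one_pow, one_mul]

end

/-! ### Weight two modulo `p ^ 2` -/

section

variable {p : ℕ} [hp : Fact p.Prime]

open UpperHalfPlane hiding I

/-- This is the Serre derivative of `E` scaled by `u = 1/(2k)`: since `G_2 = -E_2/24`, the term
`-(k/12) E_2 E` becomes `G_2 E`. -/
theorem exists_serreDerivative_series {k : ℕ} {E G : PowerSeries (pIntegers p)}
    (hE : IsModularSeries k E)
    (hG : PowerSeries.map (pIntegers p).subtype G = eisensteinG 2) {u : pIntegers p}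
    (hu : u * (2 * k) = 1) :
    IsModularSeries (k + 2) (G * E + PowerSeries.C u *
      PowerSeries.mk fun n => (n : pIntegers p) * PowerSeries.coeff n E) := by
  obtain ⟨F, hF⟩ := hE
  obtain ⟨H, hH⟩ := exists_serreDerivative F
  have huc : pIntegersToComplex p u * (2 * (k : ℂ)) = 1 := by
    have := congrArg (pIntegersToComplex p) hu
    simpa only [map_mul, map_natCast, map_ofNat, map_one] using this
  have hG' : PowerSeries.map (pIntegersToComplex p) G = PowerSeries.C (-(24 : ℂ)⁻¹) * e2Series := by
    ext n
    have hn := congrArg (PowerSeries.coeff n) hG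
    rw [PowerSeries.coeff_map, eisensteinG, PowerSeries.coeff_mk] at hn
    rw [PowerSeries.coeff_map, pIntegersToComplex_apply, PowerSeries.coeff_C_mul, e2Series,
      PowerSeries.coeff_mk]
    change ((PowerSeries.coeff n G : pIntegers p) : ℚ) = _ at hn
    rw [hn]
    split_ifs
    · rw [bernoulli_two]; push_cast; norm_num
    · push_cast; ring
  have hcast : ((k + 2 : ℕ) : ℤ) = (k : ℤ) + 2 := by push_cast; rfl
  refine ⟨ModularForm.mcast hcast.symm (pIntegersToComplex p u • H), ?_⟩
  rw [ModularForm.qExpansion_mcast _ rfl]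
  refine (ModularForm.qExpansion_smul one_pos one_mem_strictPeriods_SL _ H).trans ?_
  rw [map_add, map_mul, map_mul, PowerSeries.map_C, hG', ← hF]
  ext n
  have hn : pIntegersToComplex p (PowerSeries.coeff n E) = PowerSeries.coeff n (qExpansion 1 F) := by
    rw [hF, PowerSeries.coeff_map]
  rw [map_add, PowerSeries.coeff_smul, hH, mul_assoc (PowerSeries.C _),
    PowerSeries.coeff_C_mul, PowerSeries.coeff_C_mul, PowerSeries.coeff_map, PowerSeries.coeff_mk, RingHom.map_mul,
    map_natCast, hn,
    smul_eq_mul]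
  push_cast
  linear_combination (-(24 : ℂ)⁻¹ * PowerSeries.coeff n (e2Series * qExpansion 1 F)) * huc

theorem KummerSeq.dvd_sub_zero {R : Type*} [CommRing R] {ϖ : R} {r : ℕ} {a : ℕ → R}
    (h : KummerSeq ϖ (r + 1) a) (n : ℕ) : ϖ ∣ a n - a 0 := by
  obtain ⟨b, -, hab⟩ := h
  induction n with
  | zero => simp
  | succ n ih =>
    have := dvd_add (Dvd.intro _ (hab n).symm) ih
    simpa using this

theorem dvd_sub_one_of_coeff {E : PowerSeries (pIntegers p)} {c : ℕ → pIntegers p}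
    (hE : ∀ n, PowerSeries.coeff n E = if n = 0 then 1 else (p : pIntegers p) * c n) :
    (p : PowerSeries (pIntegers p)) ∣ E - 1 := by
  rw [← pow_one (p : PowerSeries (pIntegers p)), natCast_pow_dvd_powerSeries_iff]
  intro n
  rw [map_sub, hE, PowerSeries.coeff_one, pow_one]
  split_ifs <;> simp

/-- The `p`-deprived weight two Eisenstein series is a modular form of weight `p + 1`
modulo `p ^ 2`, up to a factor `E_{p-1}`. -/
theorem exists_weight_two_congr (hp5 : 5 ≤ p) {E : PowerSeries (pIntegers p)} {μ : pIntegers p}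
    (hE : IsModularSeries (p - 1) E) (hμ : (p : pIntegers p) ∣ μ - 1)
    (hEc : ∀ n, PowerSeries.coeff n E = if n = 0 then 1 else
        (p : pIntegers p) * (2 * (p - 1 : ℕ) * μ * (ArithmeticFunction.sigma (p - 2) n : ℕ)))
    (Φ : EisensteinFamily p 2 E) :
    ∃ A : PowerSeries (pIntegers p), IsModularSeries (p + 1) A ∧
      (p : PowerSeries (pIntegers p)) ^ 2 ∣ E * Φ.fs 0 - A := by
  have hw0 : famWeight p 2 0 = 2 := by simp [famWeight]
  have hw1 : famWeight p 2 1 = p + 1 := by simp [famWeight]; omega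
  have hodd := hp.out.odd_of_ne_two (by omega)
  have hG : PowerSeries.map (pIntegers p).subtype (Φ.f 0) = eisensteinG 2 := by
    rw [Φ.map_f, hw0]
  have hu0 : ¬ p ∣ 2 * (p - 1) := fun h => by
    rcases hp.out.dvd_mul.mp h with h | h <;> have := Nat.le_of_dvd (by omega) h <;> omega
  obtain ⟨u, hu⟩ := (pIntegers_isUnit_natCast hu0).exists_left_inv
  push_cast at hu
  have hA := exists_serreDerivative_series hE hG hu
  rw [show p - 1 + 2 = p + 1 by omega] at hA
  have hf1 : IsModularSeries (p + 1) (Φ.f 1) :=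
    isModularSeries_of_eisensteinG (by omega) hodd.add_one (by rw [Φ.map_f, hw1])
  -- The form is `A = E G_2 + u θE - p G_{p+1}` with `θ = q d/dq`. Modulo `p²`, `u θE` contributes
  -- `p T` and `G_{p+1}` may be replaced by `G_2`, while `E G_2* ≡ E G_2 - p G_2 + p T`.
  refine ⟨_, hA.add (hf1.intCast_mul (-p)), ?_⟩
  set T : PowerSeries (pIntegers p) := PowerSeries.mk fun n => (sigmaCompl p n : pIntegers p) with hT
  -- `fs 0 = G₂ - p (G₂ - T)`
  have h1 : Φ.fs 0 = Φ.f 0 - p * (Φ.f 0 - T) := by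
    ext n : 1
    rw [← map_natCast (PowerSeries.C (R := pIntegers p)), map_sub, PowerSeries.coeff_C_mul, map_sub,
      hT, PowerSeries.coeff_mk]
    rcases eq_or_ne n 0 with rfl | hn
    · rw [Φ.coeff_fs_zero, hw0]
      simp [sigmaCompl]
      ring
    · have hfn : PowerSeries.coeff n (Φ.f 0) = (ArithmeticFunction.sigma 1 n : ℕ) := by
        have := congrArg (PowerSeries.coeff n) hG
        rw [PowerSeries.coeff_map, eisensteinG, PowerSeries.coeff_mk, if_neg hn] at this
        exact Subtype.ext (by simpa using this)
      rw [Φ.coeff_fs 0 n hn, hw0, hfn]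
      have := congrArg (Nat.cast (R := pIntegers p)) (sigmaStar_one_add (p := p) n)
      push_cast at this
      linear_combination this
  -- `u θE ≡ p T`
  have h2 : (p : PowerSeries (pIntegers p)) ^ 2 ∣ PowerSeries.C u *
      (PowerSeries.mk fun n => (n : pIntegers p) * PowerSeries.coeff n E) - p * T := by
    rw [natCast_pow_dvd_powerSeries_iff]
    intro n
    rw [← map_natCast (PowerSeries.C (R := pIntegers p)), map_sub, PowerSeries.coeff_C_mul,
      PowerSeries.coeff_C_mul, hT, PowerSeries.coeff_mk, PowerSeries.coeff_mk, hEc]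
    split_ifs with hn
    · subst hn
      simp [sigmaCompl]
    · have := dvd_add (hμ.mul_right (n * (ArithmeticFunction.sigma (p - 2) n : ℕ)))
        (dvd_mul_sigma_sub_sigmaCompl (p := p) (by omega) n)
      rw [pow_two]
      refine (mul_dvd_mul_left (p : pIntegers p) this).trans (dvd_of_eq ?_)
      linear_combination (-(p : pIntegers p) * n * μ *
        (ArithmeticFunction.sigma (p - 2) n : ℕ)) * hu
  have hE1 := dvd_sub_one_of_coeff hEc
  have h3 : (p : PowerSeries (pIntegers p)) ∣ Φ.f 1 - Φ.f 0 := by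
    have a0 := Φ.dvd_f_sub_fs 0
    have a1 := (dvd_pow_self _ (by omega)).trans (Φ.dvd_f_sub_fs 1)
    rw [hw0, show 2 - 1 = 1 from rfl, pow_one] at a0
    have a2 := Φ.kummer.dvd_sub_zero 1
    have e0 := Φ.fs_eq 0
    have e1 := Φ.fs_eq 1
    have : Φ.f 1 - Φ.f 0 = (Φ.f 1 - Φ.fs 1) - (Φ.f 0 - Φ.fs 0) + (Φ.F 1 - Φ.F 0) +
        (E - 1) * Φ.F 1 := by
      linear_combination e1 - e0
    rw [this]
    exact dvd_add (dvd_add (dvd_sub a1 a0) a2) (hE1.mul_right _)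
  have h4 := dvd_add (hE1.mul_right (T - Φ.f 0)) h3
  have h5 := dvd_sub (mul_dvd_mul_left (p : PowerSeries (pIntegers p)) h4)
    ((pow_two (p : PowerSeries (pIntegers p))) ▸ h2)
  rw [pow_two]
  refine h5.trans (dvd_of_eq ?_)
  rw [h1]
  push_cast
  ring

end

/-! ### Explicit Newton interpolation of degree at most three -/

theorem two_mul_choose_two (n : ℕ) : 2 * (n.choose 2 : ℤ) = n * (n - 1) := by
  induction n with
  | zero => simp
  | succ n ih =>
    rw [Nat.choose_succ_succ' n 1, Nat.choose_one_right]
    push_cast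
    linear_combination ih

theorem six_mul_choose_three (n : ℕ) : 6 * (n.choose 3 : ℤ) = n * (n - 1) * (n - 2) := by
  induction n with
  | zero => simp
  | succ n ih =>
    rw [Nat.choose_succ_succ' n 2]
    push_cast
    linear_combination ih + 3 * two_mul_choose_two n

theorem dvd_sub_of_modEq {α i N : ℕ} (h : α ≡ i [MOD N]) : (N : ℤ) ∣ α - i :=
  Nat.modEq_iff_dvd.mp h.symm

theorem pow_dvd_sub_of_modEq {α i N r : ℕ} (h : α ≡ i [MOD N ^ r]) : (N : ℤ) ^ r ∣ α - i := by
  exact_mod_cast dvd_sub_of_modEq h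

theorem intCast_pow_dvd {p : ℕ} {R : Type*} [CommRing R] {n : ℕ} {m : ℤ} (h : (p : ℤ) ^ n ∣ m) :
    (p : R) ^ n ∣ (m : R) := by
  simpa using map_dvd (Int.castRingHom R) h

theorem famWeight_mono (p k₀ : ℕ) : Monotone (famWeight p k₀) := fun _ _ h =>
  Nat.add_le_add_right (Nat.mul_le_mul_right _ h) _

theorem five_le_famWeight {p k₀ : ℕ} (hp5 : 5 ≤ p) (hk₀ : 2 ≤ k₀) {α : ℕ} (hα : 1 ≤ α) :
    5 ≤ famWeight p k₀ α := by
  have := famWeight_mono p k₀ hα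
  have h1 : famWeight p k₀ 1 = p - 1 + k₀ := by simp [famWeight]
  omega

section

variable {R : Type*} [CommRing R] {ϖ : R} {a : ℕ → R}

theorem KummerSeq.newton_three (h : KummerSeq ϖ 4 a) (n : ℕ) :
    ϖ ^ 4 ∣ a n - (((1 - n + n.choose 2 - n.choose 3 : ℤ) : R) * a 0 +
      ((n - 2 * n.choose 2 + 3 * n.choose 3 : ℤ) : R) * a 1 +
      ((n.choose 2 - 3 * n.choose 3 : ℤ) : R) * a 2 + ((n.choose 3 : ℤ) : R) * a 3) := by
  obtain ⟨d, hd⟩ := h.newton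
  choose x hx using hd
  have h0 := hx 0
  have h1 := hx 1
  have h2 := hx 2
  have h3 := hx 3
  have hn := hx n
  -- The instances at `0, 1, 2, 3` eliminate the unknown Newton coefficients in favour of values of
  -- `a`.
  simp only [Finset.sum_range_succ, Finset.sum_range_zero, Nat.choose_zero_right,
    Nat.choose_one_right] at h0 h1 h2 h3 hn
  norm_num [Nat.choose] at h0 h1 h2 h3
  push_cast at hn ⊢
  refine ⟨x n - ((1 - n + n.choose 2 - n.choose 3 : R) * x 0 +
      (n - 2 * n.choose 2 + 3 * n.choose 3 : R) * x 1 +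
      (n.choose 2 - 3 * n.choose 3 : R) * x 2 + (n.choose 3 : R) * x 3), ?_⟩
  linear_combination hn - ((1 - n + n.choose 2 - n.choose 3 : R) * h0 +
      (n - 2 * n.choose 2 + 3 * n.choose 3 : R) * h1 +
      (n.choose 2 - 3 * n.choose 3 : R) * h2 + (n.choose 3 : R) * h3)

theorem KummerSeq.second_difference (h : KummerSeq ϖ 2 a) : ϖ ^ 2 ∣ a 2 - 2 * a 1 + a 0 := by
  obtain ⟨b, ⟨c, -, hc⟩, hb⟩ := h
  exact ⟨c 0, by linear_combination hb 1 - hb 0 + ϖ * hc 0⟩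

theorem KummerSeq.third_difference (h : KummerSeq ϖ 3 a) :
    ϖ ^ 3 ∣ a 3 - 3 * a 2 + 3 * a 1 - a 0 := by
  obtain ⟨b, hb', hb⟩ := h
  obtain ⟨c, hc⟩ := hb'.second_difference
  exact ⟨c, by linear_combination hb 2 - 2 * hb 1 + hb 0 + ϖ * hc⟩

/-- The cubic term is `n.choose 3` times a third difference, hence divisible by `ϖ · ϖ^3`. -/
theorem KummerSeq.newton_two (h : KummerSeq ϖ 4 a) {n : ℕ} (hn : ϖ ∣ (n.choose 3 : R)) :
    ϖ ^ 4 ∣ a n - (((1 - n + n.choose 2 : ℤ) : R) * a 0 +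
      ((n - 2 * n.choose 2 : ℤ) : R) * a 1 + ((n.choose 2 : ℤ) : R) * a 2) := by
  have h1 := mul_dvd_mul hn h.of_succ.third_difference
  rw [← pow_succ'] at h1
  refine (dvd_add (h.newton_three n) h1).trans (dvd_of_eq ?_)
  push_cast
  ring

theorem KummerSeq.newton_one (h : KummerSeq ϖ 4 a) {n : ℕ} (hn : ϖ ∣ (n.choose 3 : R))
    (hn' : ϖ ^ 2 ∣ (n.choose 2 : R)) :
    ϖ ^ 4 ∣ a n - (((1 - n : ℤ) : R) * a 0 + ((n : ℤ) : R) * a 1) := by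
  have h1 := mul_dvd_mul hn' h.of_succ.of_succ.second_difference
  rw [← pow_add] at h1
  refine (dvd_add (h.newton_two hn) h1).trans (dvd_of_eq ?_)
  push_cast
  ring

end

/-! ### From interpolation to filtration bounds -/

section

variable {p : ℕ} [hp : Fact p.Prime]

theorem pow_dvd_of_dvd_six_mul (hp5 : 5 ≤ p) {n : ℕ} {m : ℤ} (h : (p : ℤ) ^ n ∣ 6 * m) :
    (p : ℤ) ^ n ∣ m := by
  refine IsCoprime.dvd_of_dvd_mul_left (IsCoprime.pow_left ?_) h
  rw [show (6 : ℤ) = (6 : ℕ) from rfl, Nat.isCoprime_iff_coprime,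
    Nat.Prime.coprime_iff_not_dvd hp.out]
  intro h
  have := (hp.out.dvd_mul (m := 2) (n := 3)).mp h
  rcases this with h | h <;> have := Nat.le_of_dvd (by omega) h <;> omega

theorem pow_dvd_choose_three (hp5 : 5 ≤ p) {n r : ℕ}
    (h : (p : ℤ) ^ r ∣ n * (n - 1) * (n - 2)) : (p : ℤ) ^ r ∣ (n.choose 3 : ℤ) :=
  pow_dvd_of_dvd_six_mul hp5 (by rwa [six_mul_choose_three])

theorem pow_dvd_choose_two (hp5 : 5 ≤ p) {n r : ℕ}
    (h : (p : ℤ) ^ r ∣ n * (n - 1)) : (p : ℤ) ^ r ∣ (n.choose 2 : ℤ) :=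
  pow_dvd_of_dvd_six_mul hp5 (by
    rw [show (6 : ℤ) * (n.choose 2 : ℤ) = 3 * (n * (n - 1)) by
      linear_combination 3 * two_mul_choose_two n]
    exact h.mul_left _)

/-- Coefficients of linear interpolation at `0, 1`. -/
def newtonCoeffOne (n : ℕ) : ℕ → ℤ
  | 0 => 1 - n
  | _ => n

/-- Coefficients of quadratic interpolation at `0, 1, 2`. -/
def newtonCoeffTwo (n : ℕ) : ℕ → ℤ
  | 0 => 1 - n + n.choose 2
  | 1 => n - 2 * n.choose 2
  | _ => n.choose 2

/-- Coefficients of cubic interpolation at `0, 1, 2, 3`. -/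
def newtonCoeffThree (n : ℕ) : ℕ → ℤ
  | 0 => 1 - n + n.choose 2 - n.choose 3
  | 1 => n - 2 * n.choose 2 + 3 * n.choose 3
  | 2 => n.choose 2 - 3 * n.choose 3
  | _ => n.choose 3

/-- The coefficients `c` moved one place to the right. -/
def shiftCoeff (c : ℕ → ℤ) : ℕ → ℤ
  | 0 => 0
  | i + 1 => c i

theorem IsModularSeries.zero (w : ℕ) : IsModularSeries w (0 : PowerSeries (pIntegers p)) :=
  ⟨0, by simpa using UpperHalfPlane.qExpansion_zero 1⟩

theorem IsModularSeries.sum {ι : Type*} (s : Finset ι) {w : ℕ}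
    {f : ι → PowerSeries (pIntegers p)} (h : ∀ i ∈ s, IsModularSeries w (f i)) :
    IsModularSeries w (∑ i ∈ s, f i) := by
  classical
  induction s using Finset.induction_on with
  | empty => simpa using IsModularSeries.zero w
  | insert i s hi ih =>
    rw [Finset.sum_insert hi]
    exact (h i (by simp)).add (ih fun j hj => h j (by simp [hj]))

namespace EisensteinFamily

variable {k₀ : ℕ} {E : PowerSeries (pIntegers p)}

theorem even_famWeight (hp5 : 5 ≤ p) (hk₀ : Even k₀) (α : ℕ) : Even (famWeight p k₀ α) := by
  have : Even (p - 1) := hp.out.even_sub_one (by omega)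
  exact (this.mul_left _).add hk₀

theorem pow_four_dvd (Φ : EisensteinFamily p k₀ E) {α : ℕ} (hα : 5 ≤ famWeight p k₀ α) :
    (p : PowerSeries (pIntegers p)) ^ 4 ∣ Φ.f α - Φ.fs α :=
  (pow_dvd_pow _ (by omega)).trans (Φ.dvd_f_sub_fs α)

theorem isModularSeries_f (Φ : EisensteinFamily p k₀ E) (hp5 : 5 ≤ p) (hk₀ : Even k₀) {α : ℕ}
    (hα : 4 ≤ famWeight p k₀ α) : IsModularSeries (famWeight p k₀ α) (Φ.f α) :=
  isModularSeries_of_eisensteinG (by omega) (even_famWeight hp5 hk₀ α) (Φ.map_f α)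

theorem factorFiltration_le_of_le (Φ : EisensteinFamily p k₀ E) (hp5 : 5 ≤ p) (hk₀ : Even k₀)
    (hE : PowerSeries.map (pIntegers p).subtype E = eisensteinE (p - 1)) {α s : ℕ}
    (hα : 4 ≤ famWeight p k₀ α) (hs : α ≤ s) :
    factorFiltration p 4 (eisensteinG (famWeight p k₀ α)) ≤ famWeight p k₀ s := by
  rw [← Φ.map_f]
  exact (factorFiltration_le_weight hE (Φ.isModularSeries_f hp5 hk₀ hα)).trans
    (by exact_mod_cast famWeight_mono p k₀ hs)

/-- Multiply the combination by `E^α` and replace each deprived series by the true one. Terms with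
`i ≥ 1` have weight at least `5`, so this is free modulo `p^4`; `hc0` records what the term `i = 0`
needs, both for modularity and for the error. -/
theorem factorFiltration_le_of_combination (Φ : EisensteinFamily p k₀ E) (hp5 : 5 ≤ p)
    (hk₀ : Even k₀) (hk₀2 : 2 ≤ k₀)
    (hE : PowerSeries.map (pIntegers p).subtype E = eisensteinE (p - 1))
    (hEm : IsModularSeries (p - 1) E) {α s : ℕ} (hα : 4 ≤ famWeight p k₀ α) (c : ℕ → ℤ)
    (hc : (p : PowerSeries (pIntegers p)) ^ 4 ∣
      Φ.F α - ∑ i ∈ Finset.range (s + 1), (c i : PowerSeries (pIntegers p)) * Φ.F i)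
    (hc0 : (c 0 = 0 ∨ 4 ≤ k₀) ∧ (p : PowerSeries (pIntegers p)) ^ 4 ∣
      (c 0 : PowerSeries (pIntegers p)) * (Φ.f 0 - Φ.fs 0)) :
    factorFiltration p 4 (eisensteinG (famWeight p k₀ α)) ≤ famWeight p k₀ s := by
  -- If `α ≤ s`, the weight of `G_k` itself already meets the bound; otherwise `E^(α-s)` can be
  -- factored out.
  rcases le_or_gt α s with hs | hs
  · exact Φ.factorFiltration_le_of_le hp5 hk₀ hE hα hs
  have hterm : ∀ i, (p : PowerSeries (pIntegers p)) ^ 4 ∣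
      (c i : PowerSeries (pIntegers p)) * (Φ.f i - Φ.fs i) := fun i => by
    rcases Nat.eq_zero_or_pos i with rfl | hi
    · exact hc0.2
    · exact (Φ.pow_four_dvd (five_le_famWeight hp5 hk₀2 hi)).mul_left _
  have hmod : IsModularSeries (famWeight p k₀ s) (∑ i ∈ Finset.range (s + 1),
      (c i : PowerSeries (pIntegers p)) * (E ^ (s - i) * Φ.f i)) := by
    refine IsModularSeries.sum _ fun i hi => ?_
    have his : i ≤ s := Nat.lt_succ_iff.mp (Finset.mem_range.mp hi)
    have key : 4 ≤ famWeight p k₀ i → IsModularSeries (famWeight p k₀ s)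
        ((c i : PowerSeries (pIntegers p)) * (E ^ (s - i) * Φ.f i)) := fun h => by
      have h1 := (hEm.pow_mul (Φ.isModularSeries_f hp5 hk₀ h) (s - i)).intCast_mul (c i)
      have h2 : (s - i) * (p - 1) + famWeight p k₀ i = famWeight p k₀ s := by
        rw [famWeight, famWeight, ← add_assoc, ← add_mul, Nat.sub_add_cancel his]
      rwa [h2] at h1
    rcases Nat.eq_zero_or_pos i with rfl | hi
    · rcases hc0.1 with h | h
      · rw [h, Int.cast_zero, zero_mul]
        exact IsModularSeries.zero _
      · exact key (by simpa [famWeight] using h)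
    · exact key (by have := five_le_famWeight hp5 hk₀2 hi; omega)
  rw [← Φ.map_f]
  refine factorFiltration_le (n := α - s) hE hmod ?_
  have h1 := Φ.pow_four_dvd (five_le_famWeight hp5 hk₀2 (show 1 ≤ α by omega))
  have h2 : (p : PowerSeries (pIntegers p)) ^ 4 ∣ ∑ i ∈ Finset.range (s + 1), E ^ (α - i) *
      ((c i : PowerSeries (pIntegers p)) * (Φ.f i - Φ.fs i)) :=
    Finset.dvd_sum fun i _ => (hterm i).mul_left _
  refine (dvd_sub (dvd_add h1 (hc.mul_left (E ^ α))) h2).trans (dvd_of_eq ?_)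
  have e1 : E ^ α * ∑ i ∈ Finset.range (s + 1), (c i : PowerSeries (pIntegers p)) * Φ.F i =
      ∑ i ∈ Finset.range (s + 1), E ^ (α - i) * ((c i : PowerSeries (pIntegers p)) * Φ.fs i) := by
    rw [Finset.mul_sum]
    refine Finset.sum_congr rfl fun i hi => ?_
    have his : i < s + 1 := Finset.mem_range.mp hi
    rw [Φ.fs_eq i, show α = (α - i) + i by omega, pow_add, Nat.add_sub_cancel]
    ring
  have e2 : E ^ (α - s) * ∑ i ∈ Finset.range (s + 1),
      (c i : PowerSeries (pIntegers p)) * (E ^ (s - i) * Φ.f i) =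
      ∑ i ∈ Finset.range (s + 1), E ^ (α - i) * ((c i : PowerSeries (pIntegers p)) * Φ.f i) := by
    rw [Finset.mul_sum]
    refine Finset.sum_congr rfl fun i hi => ?_
    have his : i < s + 1 := Finset.mem_range.mp hi
    rw [show α - i = (α - s) + (s - i) by omega, pow_add]
    ring
  rw [mul_sub, e1, e2, ← Φ.fs_eq]
  simp only [mul_sub, Finset.sum_sub_distrib]
  ring

/-- Linear interpolation gives `F_0` the coefficient `1 - α`, divisible by `p²`, so `E F_0` is
needed only modulo `p²` and may be replaced by `A`. -/
theorem factorFiltration_weight_two (Φ : EisensteinFamily p 2 E) (hp5 : 5 ≤ p)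
    (hE : PowerSeries.map (pIntegers p).subtype E = eisensteinE (p - 1))
    {A : PowerSeries (pIntegers p)} (hA : IsModularSeries (p + 1) A)
    (hA2 : (p : PowerSeries (pIntegers p)) ^ 2 ∣ E * Φ.fs 0 - A) {α : ℕ} (hα : 1 ≤ α)
    (hmod : α ≡ 1 [MOD p ^ 2]) :
    factorFiltration p 4 (eisensteinG (famWeight p 2 α)) ≤ famWeight p 2 1 := by
  have hw1 : famWeight p 2 1 = p + 1 := by simp [famWeight]; omega
  have hd : (p : ℤ) ^ 2 ∣ α - 1 := by exact_mod_cast Nat.modEq_iff_dvd.mp hmod.symm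
  have hf1 := Φ.isModularSeries_f hp5 even_two (α := 1) (by omega)
  have hc2 := pow_dvd_choose_two (p := p) (n := α) hp5 (hd.mul_left _)
  have hc3 := pow_dvd_choose_three (p := p) (n := α) (r := 1) hp5
    ((((pow_dvd_pow _ (by norm_num)).trans hd).mul_left _).mul_right _)
  have hn := Φ.kummer.newton_one (n := α)
    (by simpa using intCast_pow_dvd (R := PowerSeries (pIntegers p)) hc3)
    (by simpa using intCast_pow_dvd (R := PowerSeries (pIntegers p)) hc2)
  rw [← Φ.map_f]
  refine factorFiltration_le (n := α - 1) hE
    ((hf1.intCast_mul α).add ((hw1 ▸ hA).intCast_mul (1 - α))) ?_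
  have h1 := Φ.pow_four_dvd (five_le_famWeight hp5 le_rfl hα)
  have h2 := Φ.pow_four_dvd (five_le_famWeight hp5 le_rfl (le_refl 1))
  have h3 := mul_dvd_mul (intCast_pow_dvd (R := PowerSeries (pIntegers p)) hd) hA2
  rw [← pow_add] at h3
  refine (dvd_sub (dvd_add h1 (hn.mul_left (E ^ α))) (dvd_add (h2.mul_left (E ^ (α - 1) * α))
    (h3.mul_left (E ^ (α - 1))))).trans (dvd_of_eq ?_)
  obtain ⟨β, rfl⟩ : ∃ β, α = β + 1 := ⟨α - 1, by omega⟩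
  have e0 := Φ.fs_eq 0
  have e1 := Φ.fs_eq 1
  have e2 := Φ.fs_eq (β + 1)
  rw [Nat.add_sub_cancel]
  push_cast at e0 e1 e2 ⊢
  rw [e0, e1, e2]
  ring

theorem combination_three (Φ : EisensteinFamily p k₀ E) {α : ℕ} :
    (p : PowerSeries (pIntegers p)) ^ 4 ∣ Φ.F α - ∑ i ∈ Finset.range (3 + 1),
      (newtonCoeffThree α i : PowerSeries (pIntegers p)) * Φ.F i := by
  refine (Φ.kummer.newton_three α).trans (dvd_of_eq ?_)
  simp [Finset.sum_range_succ, newtonCoeffThree]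

/-- Interpolating the shifted sequence at `1, 2, 3, 4` avoids `F 0`. The same device gives the other
shifted combinations. -/
theorem combination_four (Φ : EisensteinFamily p k₀ E) {β : ℕ} :
    (p : PowerSeries (pIntegers p)) ^ 4 ∣ Φ.F (β + 1) - ∑ i ∈ Finset.range (4 + 1),
      (shiftCoeff (newtonCoeffThree β) i : PowerSeries (pIntegers p)) * Φ.F i := by
  refine (Φ.kummer.shift.newton_three β).trans (dvd_of_eq ?_)
  simp [Finset.sum_range_succ, newtonCoeffThree, shiftCoeff]

theorem dvd_choose_three (hp5 : 5 ≤ p) {n : ℕ} (h : (p : ℤ) ∣ n * (n - 1) * (n - 2)) :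
    (p : PowerSeries (pIntegers p)) ∣ (n.choose 3 : PowerSeries (pIntegers p)) := by
  simpa using intCast_pow_dvd (R := PowerSeries (pIntegers p))
    (pow_dvd_choose_three (r := 1) hp5 (by simpa using h))

theorem combination_two (Φ : EisensteinFamily p k₀ E) (hp5 : 5 ≤ p) {α : ℕ}
    (h : (p : ℤ) ∣ α * (α - 1) * (α - 2)) :
    (p : PowerSeries (pIntegers p)) ^ 4 ∣ Φ.F α - ∑ i ∈ Finset.range (2 + 1),
      (newtonCoeffTwo α i : PowerSeries (pIntegers p)) * Φ.F i := by
  refine (Φ.kummer.newton_two (dvd_choose_three hp5 h)).trans (dvd_of_eq ?_)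
  simp [Finset.sum_range_succ, newtonCoeffTwo]

theorem combination_two_shift (Φ : EisensteinFamily p k₀ E) (hp5 : 5 ≤ p) {β : ℕ}
    (h : (p : ℤ) ∣ β * (β - 1) * (β - 2)) :
    (p : PowerSeries (pIntegers p)) ^ 4 ∣ Φ.F (β + 1) - ∑ i ∈ Finset.range (3 + 1),
      (shiftCoeff (newtonCoeffTwo β) i : PowerSeries (pIntegers p)) * Φ.F i := by
  refine (Φ.kummer.shift.newton_two (dvd_choose_three hp5 h)).trans (dvd_of_eq ?_)
  simp [Finset.sum_range_succ, newtonCoeffTwo, shiftCoeff]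

theorem sq_dvd_choose_two (hp5 : 5 ≤ p) {n : ℕ} (h : (p : ℤ) ^ 2 ∣ n * (n - 1)) :
    (p : PowerSeries (pIntegers p)) ^ 2 ∣ (n.choose 2 : PowerSeries (pIntegers p)) := by
  simpa using intCast_pow_dvd (R := PowerSeries (pIntegers p)) (pow_dvd_choose_two hp5 h)

theorem combination_one (Φ : EisensteinFamily p k₀ E) (hp5 : 5 ≤ p) {α : ℕ}
    (h : (p : ℤ) ^ 2 ∣ α * (α - 1)) :
    (p : PowerSeries (pIntegers p)) ^ 4 ∣ Φ.F α - ∑ i ∈ Finset.range (1 + 1),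
      (newtonCoeffOne α i : PowerSeries (pIntegers p)) * Φ.F i := by
  refine (Φ.kummer.newton_one (dvd_choose_three hp5
    (((dvd_pow_self _ two_ne_zero).trans h).mul_right _)) (sq_dvd_choose_two hp5 h)).trans
      (dvd_of_eq ?_)
  simp [Finset.sum_range_succ, newtonCoeffOne]

theorem combination_one_shift (Φ : EisensteinFamily p k₀ E) (hp5 : 5 ≤ p) {β : ℕ}
    (h : (p : ℤ) ^ 2 ∣ β * (β - 1)) :
    (p : PowerSeries (pIntegers p)) ^ 4 ∣ Φ.F (β + 1) - ∑ i ∈ Finset.range (2 + 1),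
      (shiftCoeff (newtonCoeffOne β) i : PowerSeries (pIntegers p)) * Φ.F i := by
  refine (Φ.kummer.shift.newton_one (dvd_choose_three hp5
    (((dvd_pow_self _ two_ne_zero).trans h).mul_right _)) (sq_dvd_choose_two hp5 h)).trans
      (dvd_of_eq ?_)
  simp [Finset.sum_range_succ, newtonCoeffOne, shiftCoeff]

end EisensteinFamily

end

/-! ### The case distinction -/

theorem corollary5p2 (p : ℕ) (hp : p.Prime) (hp5 : 5 ≤ p) (k α k₀ : ℕ)
    (hk : k = α * (p - 1) + k₀) (hk4 : 4 ≤ k) (hkeven : Even k)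
    (hk₀ : 2 ≤ k₀) (hk₀' : k₀ ≤ p - 3) :
    (6 ≤ k₀ → factorFiltration p 4 (eisensteinG k) ≤
      ((if α ≡ 0 [MOD p ^ 2] ∨ α ≡ 1 [MOD p ^ 2] then (p - 1) + k₀
        else if α ≡ 0 [MOD p] ∨ α ≡ 1 [MOD p] ∨ α ≡ 2 [MOD p] then 2 * (p - 1) + k₀
        else 3 * (p - 1) + k₀ : ℕ) : ℕ∞)) ∧
    (k₀ = 4 → factorFiltration p 4 (eisensteinG k) ≤
      ((if α ≡ 1 [MOD p ^ 2] then (p - 1) + 4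
        else if α ≡ 1 [MOD p] ∨ α ≡ 2 [MOD p] then 2 * (p - 1) + 4
        else if α ≡ 3 [MOD p] then 3 * (p - 1) + 4
        else 4 * (p - 1) + 4 : ℕ) : ℕ∞)) ∧
    (k₀ = 2 → factorFiltration p 4 (eisensteinG k) ≤
      ((if α ≡ 1 [MOD p ^ 2] then (p - 1) + 2
        else if α ≡ 2 [MOD p ^ 2] then 2 * (p - 1) + 2
        else if α ≡ 1 [MOD p] ∨ α ≡ 2 [MOD p] ∨ α ≡ 3 [MOD p] then 3 * (p - 1) + 2
        else 4 * (p - 1) + 2 : ℕ) : ℕ∞)) := by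
  have : Fact p.Prime := ⟨hp⟩
  obtain ⟨E, μ, hE, hμ, hEc⟩ := exists_eisensteinE_lift hp5
  have hpe : Even (p - 1) := hp.even_sub_one (by omega)
  have hEm := isModularSeries_of_eisensteinE (by omega) hpe hE
  obtain ⟨Φ⟩ := exists_eisensteinFamily hp5 hk₀ hk₀' (dvd_sub_one_of_coeff hEc) (by simp [hEc])
  have hk₀e : Even k₀ := by
    rw [hk] at hkeven
    exact (Nat.even_add.mp hkeven).mp (hpe.mul_left α)
  obtain rfl : k = famWeight p k₀ α := hk
  have hw : ∀ s, famWeight p k₀ s = s * (p - 1) + k₀ := fun _ => rfl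
  have bound := fun {s : ℕ} =>
    Φ.factorFiltration_le_of_combination (s := s) hp5 hk₀e hk₀ hE hEm hk4
  refine ⟨fun h6 => ?_, fun h4 => ?_, fun h2 => ?_⟩
  · have h0 : ∀ c : ℤ, (c = 0 ∨ 4 ≤ k₀) ∧ (p : PowerSeries (pIntegers p)) ^ 4 ∣
        (c : PowerSeries (pIntegers p)) * (Φ.f 0 - Φ.fs 0) := fun c =>
      ⟨Or.inr (by omega), (Φ.pow_four_dvd (by rw [hw]; omega)).mul_left _⟩
    split_ifs with c1 c2
    · rw [← one_mul (p - 1), ← hw]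
      have hd : (p : ℤ) ^ 2 ∣ α * (α - 1) := c1.elim (fun h => (by
        simpa using pow_dvd_sub_of_modEq h : (p : ℤ) ^ 2 ∣ α).mul_right _)
        fun h => (by simpa using pow_dvd_sub_of_modEq h : (p : ℤ) ^ 2 ∣ α - 1).mul_left _
      exact bound _ (Φ.combination_one hp5 hd) (h0 _)
    · rw [← hw]
      refine bound _ (Φ.combination_two hp5 ?_) (h0 _)
      rcases c2 with h | h | h <;> have := dvd_sub_of_modEq h
      · exact ((by simpa using this : (p : ℤ) ∣ α).mul_right _).mul_right _
      · exact ((by simpa using this : (p : ℤ) ∣ α - 1).mul_left _).mul_right _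
      · exact (by simpa using this : (p : ℤ) ∣ α - 2).mul_left _
    · rw [← hw]
      exact bound _ Φ.combination_three (h0 _)
  · subst h4
    -- In weight `4` depriving costs only `p^3`, so one factor `p` must come from the coefficient of
    -- `F 0`.
    have h0 : ∀ c : ℤ, (p : ℤ) ∣ c → (c = 0 ∨ 4 ≤ 4) ∧ (p : PowerSeries (pIntegers p)) ^ 4 ∣
        (c : PowerSeries (pIntegers p)) * (Φ.f 0 - Φ.fs 0) := fun c hc => by
      refine ⟨Or.inr le_rfl, ?_⟩
      have h1 := Φ.dvd_f_sub_fs 0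
      rw [hw, zero_mul] at h1
      have h2 := intCast_pow_dvd (n := 1) (R := PowerSeries (pIntegers p)) (by simpa using hc)
      rw [pow_one] at h2
      exact (pow_succ' (p : PowerSeries (pIntegers p)) 3) ▸ mul_dvd_mul h2 h1
    split_ifs with c1 c2 c3
    · rw [← one_mul (p - 1), ← hw]
      have hd : (p : ℤ) ^ 2 ∣ α - 1 := by simpa using pow_dvd_sub_of_modEq c1
      refine bound _ (Φ.combination_one hp5 (hd.mul_left _)) (h0 _ ?_)
      rw [← dvd_neg]
      simpa [newtonCoeffOne] using (dvd_pow_self _ two_ne_zero).trans hd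
    · rw [← hw]
      have hd : (p : ℤ) ∣ (α - 1) * (α - 2) := by
        rcases c2 with h | h <;> have := dvd_sub_of_modEq h
        · exact (by simpa using this : (p : ℤ) ∣ α - 1).mul_right _
        · exact (by simpa using this : (p : ℤ) ∣ α - 2).mul_left _
      refine bound _ (Φ.combination_two hp5 ?_) (h0 _ ?_)
      · rw [mul_assoc]
        exact hd.mul_left _
      -- The coefficient of `F 0` is `(α-1)(α-2)/2`; in the cubic case below it is
      -- `-(α-1)(α-2)(α-3)/6`. This is why `α ≡ 0` is absent from the lists for `k₀ = 4`.
      · have := pow_dvd_of_dvd_six_mul (p := p) (n := 1) hp5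
          (m := 1 - α + α.choose 2) (by
            rw [show (6 : ℤ) * (1 - α + α.choose 2) = 3 * ((α - 1) * (α - 2)) by
              linear_combination 3 * two_mul_choose_two α]
            simpa using hd.mul_left 3)
        simpa [newtonCoeffTwo] using this
    · rw [← hw]
      refine bound _ Φ.combination_three (h0 _ ?_)
      have hd : (p : ℤ) ∣ α - 3 := by
        simpa using dvd_sub_of_modEq c3
      have := pow_dvd_of_dvd_six_mul (p := p) (n := 1) hp5
          (m := 1 - α + α.choose 2 - α.choose 3) (by
            rw [show (6 : ℤ) * (1 - α + α.choose 2 - α.choose 3) =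
              -((α - 1) * (α - 2)) * (α - 3) by
              linear_combination 3 * two_mul_choose_two α - six_mul_choose_three α]
            simpa using hd.mul_left (-((α - 1) * (α - 2) : ℤ)))
      simpa [newtonCoeffThree] using this
    · rw [← hw]
      -- For `α = 0` there is no shifted index `α - 1`, but `G_4` itself satisfies the bound.
      rcases Nat.eq_zero_or_pos α with rfl | hα
      · exact Φ.factorFiltration_le_of_le hp5 hk₀e hE hk4 (by omega)
      · obtain ⟨β, rfl⟩ : ∃ β, α = β + 1 := ⟨α - 1, by omega⟩
        exact bound _ Φ.combination_four (by simp [shiftCoeff])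
  · subst h2
    -- Weight `2` is excluded by `4 ≤ k`, so `α ≥ 1` and the shifted interpolation with `β = α - 1`
    -- always applies.
    obtain ⟨β, rfl⟩ : ∃ β, α = β + 1 := ⟨α - 1, by
      have : α ≠ 0 := by rintro rfl; rw [hw] at hk4; omega
      omega⟩
    split_ifs with c1 c2 c3
    · rw [← one_mul (p - 1), ← hw]
      obtain ⟨A, hA, hA2⟩ := exists_weight_two_congr hp5 hEm hμ hEc Φ
      exact Φ.factorFiltration_weight_two hp5 hE hA hA2 (by omega) c1
    · rw [← hw]
      have hd : (p : ℤ) ^ 2 ∣ β - 1 := by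
        simpa using pow_dvd_sub_of_modEq (Nat.ModEq.add_right_cancel' (b := 1) 1 c2)
      exact bound _ (Φ.combination_one_shift hp5 (hd.mul_left _)) (by simp [shiftCoeff])
    · rw [← hw]
      refine bound _ (Φ.combination_two_shift hp5 ?_) (by simp [shiftCoeff])
      rcases c3 with h | h | h
      · have := dvd_sub_of_modEq (Nat.ModEq.add_right_cancel' (b := 0) 1 h)
        exact ((by simpa using this : (p : ℤ) ∣ β).mul_right _).mul_right _
      · have := dvd_sub_of_modEq (Nat.ModEq.add_right_cancel' (b := 1) 1 h)
        exact ((by simpa using this : (p : ℤ) ∣ β - 1).mul_left _).mul_right _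
      · have := dvd_sub_of_modEq (Nat.ModEq.add_right_cancel' (b := 2) 1 h)
        exact (by simpa using this : (p : ℤ) ∣ β - 2).mul_left _
    · rw [← hw]
      exact bound _ Φ.combination_four (by simp [shiftCoeff])
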